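/- Let $S$ be a separated Noetherian scheme of finite Krull dimension and let $G\to S$ be a flat group scheme which is separated and of finite type over $S$. Let $\mathrm{Sch}^G_S$ be the category of separated $S$-schemes of finite type with a left $G$-action over $S$, with the $G$-equivariant $S$-morphisms. A *distinguished equivariant Nisnevich square* is a cartesian square in $\mathrm{Sch}^G_S$ $$\begin{array}{ccc} B & \to & Y\\ \downarrow & & \downarrow{\scriptstyle p}\\ A & \xrightarrow{\,j\,} & X\end{array}$$ in which $j$ is an open immersion, $p$ is étale, and the induced morphism $(Y\setminus B)_{\mathrm{red}}\to (X\setminus A)_{\mathrm{red}}$ is an isomorphism. These squares form the *equivariant Nisnevich cd-structure*; the *equivariant Nisnevich topology* is the smallest Grothendieck topology on $\mathrm{Sch}^G_S$ for which the sieve generated by $j$ and $p$ covers $X$ for each distinguished square and the empty sieve covers $\emptyset$. Then the following hold. 1. The cd-structure is *complete*: every covering sieve of an object not isomorphic to $\emptyset$ contains the sieve generated by a simple covering. (Simple coverings are the smallest class of families containing the one-element families given by isomorphisms and containing $\{p\circ p_i\}\cup\{j\circ q_k\}$ for each distinguished square as above and all simple coverings $\{p_i\}$ of $Y$ and $\{q_k\}$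 of $A$.) 2. The cd-structure is *regular*: for each distinguished square, the square is cartesian, $A\to X$ is a monomorphism, and the morphism of sheaves $\rho(Y)\amalg \rho(B)\times_{\rho(A)}\rho(B)\to \rho(Y)\times_{\rho(X)}\rho(Y)$ is surjective, where $\rho(-)$ is the sheaf associated with the represented presheaf. 3. The cd-structure is *bounded*: there is a density structure $D$, i.e. for each object $X$ a sequence of classes $D_0(X)\supseteq D_1(X)\supseteq\cdots$ of morphisms to $X$, with $(\emptyset\to X)\in D_0(X)$, containing the isomorphisms, and such that $V\to U$ in $D_i(U)$ and $U\to X$ in $D_i(X)$ imply that the composite is in $D_i(X)$, with the following two properties. First, $D$ is locally of finite dimension: for each $X$ there is an $n$ such that all elements of $D_{n+1}(X)$ are isomorphisms. Second, each distinguished square has a refinement (a distinguished square mapping to it by an isomorphism on the lower right corner) that is reducing. Here a square as above is reducing if for all $i\ge 0$ and all $B_0\in D_i(B)$, $Y_0\in D_{i+1}(Y)$, $A_0\in D_{i+1}(A)$ there are a distinguished square with corners $B',Y',A',X'$ and a morphism from it to the given square such that $X'\to X$ is in $D_{i+1}(X)$ and $B'\to B$, $Y'\to Y$, $A'\to A$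 factor through $B_0$, $Y_0$, $A_0$ respectively. 4. A presheaf of sets $F$ on $\mathrm{Sch}^G_S$ is a sheaf for the equivariant Nisnevich topology if and only if $F(\emptyset)$ is a one-point set and $F$ sends each distinguished square to a cartesian square of sets. 5. The equivariant Nisnevich topology is subcanonical. 6. For each sheaf of abelian groups $F$ for the equivariant Nisnevich topology and each $X$ in $\mathrm{Sch}^G_S$, $H^i_{G\mathrm{Nis}}(X,F)=0$ for all $i>\dim X$, where $\dim X$ is the Krull dimension. -/

import Mathlib

open CategoryTheory Limits Opposite AlgebraicGeometry

universe w v u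

namespace EquivariantNisnevich

/-! ### cd-structures in the sense of Voevodsky

A `Square C` is written as
```
X₁ = B --f₁₂--> X₂ = Y
  |               |
 f₁₃             f₂₄ = p
  v               v
X₃ = A --f₃₄--> X₄ = X
```
-/

/-- A cd-structure on a category with an initial object: a class of commutative squares
which is closed under isomorphisms of squares. -/
structure CDStructure (C : Type u) [Category.{v} C] [HasInitial C] where
  /-- The class of distinguished squares. -/
  Distinguished : ObjectProperty (Square C)
  of_iso : ∀ {Q Q' : Square C}, (Q ≅ Q') → Distinguished Q → Distinguished Q'

namespace CDStructure

variable {C : Type u} [Category.{v} C] [HasInitial C] (P : CDStructure C)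

/-- The smallest Grothendieck topology for which the sieve generated by `Y ⟶ X` and `A ⟶ X`
is covering for each distinguished square, and the empty sieve covers the initial object. -/
def topology : GrothendieckTopology C :=
  sInf {J | (∀ Q : Square C, P.Distinguished Q → Sieve.ofTwoArrows Q.f₂₄ Q.f₃₄ ∈ J Q.X₄) ∧
    (⊥ : Sieve (⊥_ C)) ∈ J (⊥_ C)}

/-- The smallest class of families of morphisms with a common target that contains the
one-element families consisting of an isomorphism, and contains `{p ∘ pᵢ} ∪ {e ∘ qⱼ}` for each
distinguished square (with sides `p : Y ⟶ X` and `e : A ⟶ X`) and all families `{pᵢ}` over `Y`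
and `{qⱼ}` over `A` in the class. -/
inductive SimpleCovering : ∀ X : C, Presieve X → Prop
  | of_isIso {X' X : C} (f : X' ⟶ X) (hf : IsIso f) : SimpleCovering X (Presieve.singleton f)
  | of_square (Q : Square C) (hQ : P.Distinguished Q) (R : Presieve Q.X₂) (T : Presieve Q.X₃)
      (hR : SimpleCovering Q.X₂ R) (hT : SimpleCovering Q.X₃ T) :
      SimpleCovering Q.X₄ (fun U g ↦ (∃ h : U ⟶ Q.X₂, R h ∧ h ≫ Q.f₂₄ = g) ∨
        (∃ h : U ⟶ Q.X₃, T h ∧ h ≫ Q.f₃₄ = g))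

/-- A cd-structure is complete if each covering sieve of an object which is not isomorphic to the
initial object contains the sieve generated by a simple covering. -/
def IsComplete : Prop :=
  ∀ X : C, IsEmpty (X ≅ ⊥_ C) → ∀ R ∈ P.topology X,
    ∃ T : Presieve X, P.SimpleCovering X T ∧ Sieve.generate T ≤ R

end CDStructure

/-- For a square with corners `B, Y, A, X`, the morphism `Y ⨿ (B ×_A B) ⟶ Y ×_X Y` given by
the diagonal of `Y` over `X` and by `B ⟶ Y` on both factors. -/
noncomputable def diagonalMap {D : Type u} [Category.{v} D] [HasPullbacks D]
    [HasBinaryCoproducts D] (Q : Square D) :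
    Q.X₂ ⨿ pullback Q.f₁₃ Q.f₁₃ ⟶ pullback Q.f₂₄ Q.f₂₄ :=
  coprod.desc (pullback.diagonal Q.f₂₄)
    (pullback.map _ _ _ _ Q.f₁₂ Q.f₁₂ Q.f₃₄ Q.fac.symm Q.fac.symm)

section Regular

variable {C : Type u} [Category.{v} C]

instance hasBinaryCoproducts_sheaf (J : GrothendieckTopology C) [HasSheafify J (Type v)] :
    HasBinaryCoproducts (Sheaf J (Type v)) :=
  have : HasColimitsOfShape (Discrete WalkingPair) (Cᵒᵖ ⥤ Type v) :=
    functorCategoryHasColimitsOfShape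
  hasColimitsOfShape_of_reflective (sheafToPresheaf J (Type v))

/-- The functor sending an object to the sheaf associated with the presheaf it represents. -/
noncomputable abbrev rho (J : GrothendieckTopology C) [HasSheafify J (Type v)] :
    C ⥤ Sheaf J (Type v) :=
  yoneda ⋙ presheafToSheaf J (Type v)

/-- A cd-structure is regular if each distinguished square is cartesian, has a monomorphism
`A ⟶ X` as its lower side, and the morphism of sheaves
`ρ(Y) ⨿ ρ(B) ×_{ρ(A)} ρ(B) ⟶ ρ(Y) ×_{ρ(X)} ρ(Y)` is surjective. -/
def CDStructure.IsRegular [HasInitial C] (P : CDStructure C)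
    [HasSheafify P.topology (Type v)] : Prop :=
  ∀ Q : Square C, P.Distinguished Q → Q.IsPullback ∧ Mono Q.f₃₄ ∧
    Sheaf.IsLocallySurjective (diagonalMap (Q.map (rho P.topology)))

end Regular

/-- A density structure on a category with an initial object: for each object `X` and each
`i ≥ 0` a class `D_i(X)` of morphisms to `X`. -/
structure DensityStructure (C : Type u) [Category.{v} C] [HasInitial C] where
  /-- `D i f` means that `f : U ⟶ X` belongs to `D_i(X)`. -/
  D : ℕ → MorphismProperty C
  initial_mem : ∀ X : C, D 0 (initial.to X)
  of_isIso : ∀ (i : ℕ) {U X : C} (f : U ⟶ X), IsIso f → D i f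
  anti : ∀ i : ℕ, D (i + 1) ≤ D i
  comp : ∀ (i : ℕ) {V U X : C} (f : V ⟶ U) (g : U ⟶ X), D i f → D i g → D i (f ≫ g)

section Bounded

variable {C : Type u} [Category.{v} C] [HasInitial C]

/-- For each object `X` there is an `n` such that `D_{n+1}(X)` consists of isomorphisms. -/
def DensityStructure.IsLocallyFiniteDimensional (D : DensityStructure C) : Prop :=
  ∀ X : C, ∃ n : ℕ, ∀ (U : C) (f : U ⟶ X), D.D (n + 1) f → IsIso f

/-- A square `Q` is reducing if for all `B₀ ∈ D_i(B)`, `Y₀ ∈ D_{i+1}(Y)`, `A₀ ∈ D_{i+1}(A)` there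
are a distinguished square `Q'` and a morphism `Q' ⟶ Q` that is in `D_{i+1}(X)` on the
lower right corner and factors through `B₀`, `Y₀`, `A₀` on the other corners. -/
def DensityStructure.IsReducing (D : DensityStructure C) (P : CDStructure C)
    (Q : Square C) : Prop :=
  ∀ (i : ℕ) {B₀ Y₀ A₀ : C} (b : B₀ ⟶ Q.X₁) (y : Y₀ ⟶ Q.X₂) (a : A₀ ⟶ Q.X₃),
    D.D i b → D.D (i + 1) y → D.D (i + 1) a →
    ∃ (Q' : Square C) (φ : Q' ⟶ Q), P.Distinguished Q' ∧ D.D (i + 1) φ.τ₄ ∧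
      (∃ t : Q'.X₁ ⟶ B₀, t ≫ b = φ.τ₁) ∧ (∃ t : Q'.X₂ ⟶ Y₀, t ≫ y = φ.τ₂) ∧
      (∃ t : Q'.X₃ ⟶ A₀, t ≫ a = φ.τ₃)

/-- A cd-structure is bounded if there is a density structure, locally of finite dimension, such
that each distinguished square has a refinement by a reducing distinguished square. -/
def CDStructure.IsBounded (P : CDStructure C) : Prop :=
  ∃ D : DensityStructure C, D.IsLocallyFiniteDimensional ∧
    ∀ Q : Square C, P.Distinguished Q →
      ∃ (Q' : Square C) (φ : Q' ⟶ Q), P.Distinguished Q' ∧ IsIso φ.τ₄ ∧ D.IsReducing P Q'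

end Bounded

/-! ### Schemes with an action of a group scheme -/

/-- The property of a morphism to `S` to be separated and of finite type. -/
def IsSchemeOver (S : Scheme.{u}) : ObjectProperty (Over S) :=
  fun X ↦ IsSeparated X.hom ∧ LocallyOfFiniteType X.hom ∧ QuasiCompact X.hom

/-- The category of separated schemes of finite type over `S` equipped with a left action of
the group scheme `G`, and of `G`-equivariant morphisms over `S`. -/
abbrev GSch {S : Scheme.{u}} (G : Over S) [GrpObj G] : Type (u + 1) :=
  ObjectProperty.FullSubcategory fun X : CategoryTheory.Mod (Over S) G ↦ IsSchemeOver S X.X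

/-- The underlying scheme of a `G`-scheme. -/
noncomputable def GSch.forget {S : Scheme.{u}} (G : Over S) [GrpObj G] : GSch G ⥤ Scheme.{u} :=
  ObjectProperty.ι _ ⋙ CategoryTheory.Mod.forget G ⋙ Over.forget S

/-! ### The empty `G`-scheme -/

section Empty

open MonoidalCategory

variable {S : Scheme.{u}}

theorem hom_unique {X Y : Over S} (hX : IsEmpty X.left) (f g : X ⟶ Y) : f = g := by
  ext1
  exact (isInitialOfIsEmpty (X := X.left)).hom_ext _ _

theorem isEmpty_tensor {X : Over S} (hX : IsEmpty X.left) (Y : Over S) :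
    IsEmpty (Y ⊗ X).left :=
  Function.isEmpty (SemiCartesianMonoidalCategory.snd Y X).left.base

/-- The empty scheme over `S`. -/
noncomputable def emptyOver (S : Scheme.{u}) : Over S := Over.mk (Scheme.emptyTo S)

theorem isEmpty_emptyOver (S : Scheme.{u}) : IsEmpty (emptyOver S).left :=
  inferInstanceAs (IsEmpty (∅ : Scheme.{u}))

variable (G : Over S) [GrpObj G]

/-- The empty scheme with its unique `G`-action. -/
noncomputable def GSch.empty : GSch G where
  obj :=
    { X := emptyOver S
      mod :=
        { smul := SemiCartesianMonoidalCategory.snd G (emptyOver S)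
          one_smul := hom_unique (isEmpty_tensor (isEmpty_emptyOver S) _) _ _
          mul_smul := hom_unique (isEmpty_tensor (isEmpty_emptyOver S) _) _ _ } }
  property := by
    have : IsEmpty (emptyOver S).left := isEmpty_emptyOver S
    refine ⟨?_, ?_, ?_⟩ <;> dsimp <;> infer_instance

noncomputable def GSch.emptyIsInitial : IsInitial (GSch.empty G) :=
  IsInitial.ofUniqueHom
    (fun X ↦ ObjectProperty.homMk
      (CategoryTheory.Mod.Hom.mk'
        (Over.homMk (Scheme.emptyTo X.obj.X.left)
          ((isInitialOfIsEmpty (X := (∅ : Scheme.{u}))).hom_ext _ _))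
        (hom_unique (isEmpty_tensor (isEmpty_emptyOver S) _) _ _)))
    (fun X f ↦ by
      apply ObjectProperty.hom_ext
      apply CategoryTheory.Mod.hom_ext
      exact hom_unique (isEmpty_emptyOver S) _ _)

instance : HasInitial (GSch G) := (GSch.emptyIsInitial G).hasInitial

end Empty

/-! ### The category of `G`-schemes is essentially small

This provides the sheafification of presheaves of sets and of abelian groups, and the `Ext` groups
of sheaves, in the universe of the base scheme. -/

section Small

theorem essentiallySmall_affine (S : Scheme.{u}) (P : MorphismProperty Scheme.{u})
    (hP : P ≤ @LocallyOfFiniteType) [P.RespectsIso] :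
    ObjectProperty.EssentiallySmall.{u} (fun X : Scheme.{u} ↦ IsAffine X ∧ ∃ f : X ⟶ S, P f) := by
  have := essentiallySmall_costructuredArrow_Spec (X := S) P hP
  let F := MorphismProperty.CostructuredArrow.forget P ⊤ Scheme.Spec S ⋙
    CostructuredArrow.proj _ _ ⋙ Scheme.Spec
  refine .of_le (Q := F.essImage) ?_
  rintro X ⟨hX, f, hf⟩
  exact ⟨.mk ⊤ (A := op Γ(X, ⊤)) (X.isoSpec.inv ≫ f)
    ((P.cancel_left_of_respectsIso _ _).mpr hf), ⟨X.isoSpec.symm⟩⟩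

theorem essentiallySmall_scheme (S : Scheme.{u}) [CompactSpace S] [S.IsSeparated] :
    ObjectProperty.EssentiallySmall.{u} (fun X : Scheme.{u} ↦
      ∃ f : X ⟶ S, IsSeparated f ∧ LocallyOfFiniteType f ∧ QuasiCompact f) := by
  let Aff : ObjectProperty Scheme.{u} := fun X ↦ IsAffine X ∧ ∃ f : X ⟶ S, LocallyOfFiniteType f
  have : ObjectProperty.EssentiallySmall.{u} Aff :=
    have : MorphismProperty.RespectsIso (@LocallyOfFiniteType.{u}) :=
      MorphismProperty.IsStableUnderBaseChange.respectsIso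
    essentiallySmall_affine S _ le_rfl
  let J : ℕ → Type u := fun n ↦ WalkingMultispan (.prod (ULift.{u} (Fin n)))
  refine .of_le (Q := Aff.colimitsClosure J) ?_
  rintro X ⟨f, hs, hf, hq⟩
  have : CompactSpace X := QuasiCompact.compactSpace_of_compactSpace f
  have : X.IsSeparated := ⟨by rw [← terminal.comp_from f]; infer_instance⟩
  let 𝒰₀ := X.affineCover.finiteSubcover
  have hfin : Finite 𝒰₀.I₀ := inferInstance
  let e : ULift.{u} (Fin (Nat.card 𝒰₀.I₀)) ≃ 𝒰₀.I₀ := Equiv.ulift.trans (Finite.equivFin _).symm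
  let 𝒰 : X.OpenCover := 𝒰₀.reindex e
  have haff : ∀ i, IsAffine (𝒰.X i) := fun i ↦ inferInstanceAs (IsAffine (X.affineCover.X _))
  have hopen : ∀ i, IsOpenImmersion (𝒰.f i) := fun i ↦ 𝒰.map_prop i
  have hft : ∀ i, LocallyOfFiniteType (𝒰.f i ≫ f) := fun i ↦ inferInstance
  have hpull : ∀ i j, Aff (pullback (𝒰.f i) (𝒰.f j)) := by
    intro i j
    have : IsAffineHom (𝒰.f i ≫ terminal.from X) := inferInstance
    have : IsAffineHom (𝒰.f i) := .of_comp _ (terminal.from X)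
    exact ⟨inferInstance, pullback.fst (𝒰.f i) (𝒰.f j) ≫ 𝒰.f i ≫ f, inferInstance⟩
  refine ObjectProperty.prop_of_iso _ (asIso 𝒰.fromGlued) ?_
  have hc : HasColimit 𝒰.gluedCover.diagram.multispan :=
    inferInstanceAs (HasMulticoequalizer 𝒰.gluedCover.toGlueData.diagram)
  let pres : ColimitPresentation (WalkingMultispan (.prod (ULift.{u} (Fin (Nat.card 𝒰₀.I₀)))))
      𝒰.gluedCover.glued :=
    ⟨𝒰.gluedCover.diagram.multispan, (colimit.cocone _).ι, @colimit.isColimit _ _ _ _ _ hc⟩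
  refine .of_colimitPresentation (a := Nat.card 𝒰₀.I₀) pres ?_
  rintro (⟨i, j⟩ | i) <;> apply ObjectProperty.le_colimitsClosure
  · exact hpull i j
  · exact ⟨haff i, 𝒰.f i ≫ f, hft i⟩

theorem essentiallySmall_isSchemeOver (S : Scheme.{u}) [CompactSpace S] [S.IsSeparated] :
    ObjectProperty.EssentiallySmall.{u} (IsSchemeOver S) := by
  have := essentiallySmall_scheme S
  refine .of_functor _ (Over.forget S) ?_ ?_
  · refine .of_le (Q := .isoClosure fun X : Scheme.{u} ↦
      ∃ f : X ⟶ S, IsSeparated f ∧ LocallyOfFiniteType f ∧ QuasiCompact f) ?_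
    rintro Y ⟨X, hX, ⟨e⟩⟩
    exact ⟨X.left, ⟨X.hom, hX⟩, ⟨e.symm⟩⟩
  · intro Y
    refine ⟨.ofObj fun f : Y ⟶ S ↦ Over.mk f, inferInstance, ?_⟩
    rintro X ⟨-, ⟨e⟩⟩
    exact ⟨_, ⟨e.inv ≫ X.hom⟩, ⟨Over.isoMk e (e.hom_inv_id_assoc X.hom)⟩⟩

variable {S : Scheme.{u}} [CompactSpace S] [S.IsSeparated] (G : Over S) [GrpObj G]

instance essentiallySmall_gSch : EssentiallySmall.{u} (GSch G) := by
  have := essentiallySmall_isSchemeOver S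
  suffices ObjectProperty.EssentiallySmall.{u}
      fun X : CategoryTheory.Mod (Over S) G ↦ IsSchemeOver S X.X from inferInstance
  refine .of_functor _ (CategoryTheory.Mod.forget G) ?_ ?_
  · refine .of_le (Q := (IsSchemeOver S).isoClosure) ?_
    rintro Y ⟨X, hX, ⟨e⟩⟩
    exact ⟨X.X, hX, ⟨e.symm⟩⟩
  · intro Y
    have : Small.{u} (ModObj G Y) := small_of_injective (f := fun m : ModObj G Y ↦ m.smul)
      (fun a b h ↦ ModObj.ext a b h)
    refine ⟨.ofObj fun m : ModObj G Y ↦ ⟨Y⟩, inferInstance, ?_⟩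
    rintro X ⟨-, ⟨e⟩⟩
    change X.X ≅ Y at e
    have : IsMonHom (Iso.refl G).hom := inferInstanceAs (IsMonHom (𝟙 G))
    let m : ModObj G Y := ModObj.ofIso (Iso.refl G) e
    refine ⟨_, ⟨m⟩, ⟨⟨.mk' e.hom ?_, .mk' e.inv ?_, ?_, ?_⟩⟩⟩
    · simp [m, ModObj.ofIso_smul]
    · simp [m, ModObj.ofIso_smul]
    · ext1; simp
    · ext1; simp

variable (J : GrothendieckTopology (GSch G))

instance hasSheafify_type : HasSheafify J (Type u) := hasSheafifyEssentiallySmallSite.{u} _ _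

instance hasSheafify_ab : HasSheafify J AddCommGrpCat.{u} :=
  hasSheafifyEssentiallySmallSite.{u} _ _

instance isGrothendieckAbelian_sheaf : IsGrothendieckAbelian.{u} (Sheaf J AddCommGrpCat.{u}) :=
  Sheaf.isGrothendieckAbelian_of_essentiallySmall J AddCommGrpCat.{u}

instance hasExt_sheaf : HasExt.{u} (Sheaf J AddCommGrpCat.{u}) :=
  hasExt_of_enoughInjectives.{u} _

end Small

/-! ### The equivariant Nisnevich cd-structure -/

/-- The ideal sheaf of the closed complement of the image of an open immersion `f : U ⟶ X`, with its
reduced structure; its `subscheme` is `(X ∖ U)_red`. (Taking the closure only serves to have a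
definition for all morphisms.) -/
noncomputable def complementIdeal {U X : Scheme.{u}} (f : U ⟶ X) : X.IdealSheafData :=
  Scheme.IdealSheafData.vanishingIdeal (TopologicalSpace.Closeds.closure (Set.range f)ᶜ)

theorem exists_iso_complement {U X U' X' : Scheme.{u}} (f : U ⟶ X) (f' : U' ⟶ X') (a : U' ⟶ U)
    (b : X' ⟶ X) [IsIso a] [IsIso b] (h : f' ≫ b = a ≫ f) :
    ∃ r : (complementIdeal f').subscheme ⟶ (complementIdeal f).subscheme,
      r ≫ (complementIdeal f).subschemeι = (complementIdeal f').subschemeι ≫ b ∧ IsIso r := by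
  have hker : (complementIdeal f).subschemeι.ker = ((complementIdeal f').subschemeι ≫ b).ker := by
    rw [Scheme.Hom.ker_comp, Scheme.IdealSheafData.ker_subschemeι,
      Scheme.IdealSheafData.ker_subschemeι]
    unfold complementIdeal
    rw [Scheme.IdealSheafData.map_vanishingIdeal]
    congr 1
    ext1
    have hb : IsHomeomorph b := (Scheme.homeoOfIso (asIso b)).isHomeomorph
    have ha : Function.Surjective a := (Scheme.homeoOfIso (asIso a)).surjective
    have : (Set.range f)ᶜ = b '' (Set.range f')ᶜ := by
      rw [Set.image_compl_eq hb.bijective, ← Set.range_comp, ← ha.range_comp]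
      congr 2
      exact congr_arg (fun g : U' ⟶ X ↦ (g : U' → X)) h.symm
    simp only [TopologicalSpace.Closeds.coe_closure]
    rw [this, ← hb.isClosedMap.closure_image_eq_of_continuous hb.continuous, closure_closure]
  exact ⟨_, IsClosedImmersion.lift_fac _ _ hker.le, IsClosedImmersion.isIso_lift _ _ hker⟩

variable {S : Scheme.{u}} (G : Over S) [GrpObj G]

/-- A distinguished equivariant Nisnevich square: a cartesian square of `G`-schemes in which
`A ⟶ X` is an open immersion, `p : Y ⟶ X` is étale, and the morphism
`(Y ∖ B)_red ⟶ (X ∖ A)_red` induced by `p` is an isomorphism. (The morphism `r` below is unique,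
since `(X ∖ A)_red ⟶ X` is a monomorphism.) -/
structure IsDistinguished (Q : Square (GSch G)) : Prop where
  isPullback : Q.IsPullback
  isOpenImmersion : IsOpenImmersion ((GSch.forget G).map Q.f₃₄)
  etale : Etale ((GSch.forget G).map Q.f₂₄)
  isIso_complement :
    ∃ r : (complementIdeal ((GSch.forget G).map Q.f₁₂)).subscheme ⟶
        (complementIdeal ((GSch.forget G).map Q.f₃₄)).subscheme,
      r ≫ (complementIdeal ((GSch.forget G).map Q.f₃₄)).subschemeι =
        (complementIdeal ((GSch.forget G).map Q.f₁₂)).subschemeι ≫ (GSch.forget G).map Q.f₂₄ ∧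
      IsIso r

theorem IsDistinguished.of_iso {Q Q' : Square (GSch G)} (e : Q ≅ Q')
    (h : IsDistinguished G Q) : IsDistinguished G Q' := by
  have hom : ∀ {R R' : Square (GSch G)} (e : R ≅ R'),
      IsIso e.hom.τ₁ ∧ IsIso e.hom.τ₂ ∧ IsIso e.hom.τ₃ ∧ IsIso e.hom.τ₄ := fun e ↦
    ⟨(Square.evaluation₁.mapIso e).isIso_hom, (Square.evaluation₂.mapIso e).isIso_hom,
      (Square.evaluation₃.mapIso e).isIso_hom, (Square.evaluation₄.mapIso e).isIso_hom⟩
  obtain ⟨h₁, h₂, h₃, h₄⟩ := hom e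
  obtain ⟨k₁, k₂, k₃, k₄⟩ := hom e.symm
  let F := GSch.forget G
  have c₁₂ : F.map Q'.f₁₂ ≫ F.map e.inv.τ₂ = F.map e.inv.τ₁ ≫ F.map Q.f₁₂ := by
    simp only [← Functor.map_comp, e.inv.comm₁₂]
  have c₂₄ : F.map Q'.f₂₄ ≫ F.map e.inv.τ₄ = F.map e.inv.τ₂ ≫ F.map Q.f₂₄ := by
    simp only [← Functor.map_comp, e.inv.comm₂₄]
  have c₃₄ : F.map Q'.f₃₄ ≫ F.map e.inv.τ₄ = F.map e.inv.τ₃ ≫ F.map Q.f₃₄ := by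
    simp only [← Functor.map_comp, e.inv.comm₃₄]
  have d₃₄ : F.map Q.f₃₄ ≫ F.map e.hom.τ₄ = F.map e.hom.τ₃ ≫ F.map Q'.f₃₄ := by
    simp only [← Functor.map_comp, e.hom.comm₃₄]
  have t₄ : F.map e.inv.τ₄ ≫ F.map e.hom.τ₄ = 𝟙 _ := by
    rw [← Functor.map_comp, ← CategoryTheory.Functor.map_id]
    exact congr_arg F.map (congr_arg Square.Hom.τ₄ e.inv_hom_id)
  dsimp only [Iso.symm_hom] at k₁ k₂ k₃ k₄
  refine ⟨h.isPullback.of_iso e, ?_, ?_, ?_⟩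
  · have := h.isOpenImmersion
    have : F.map Q'.f₃₄ = F.map e.inv.τ₃ ≫ F.map Q.f₃₄ ≫ F.map e.hom.τ₄ := by
      rw [← reassoc_of% c₃₄, t₄, Category.comp_id]
    change IsOpenImmersion (F.map Q'.f₃₄)
    rw [this]
    infer_instance
  · have := h.etale
    have : F.map Q'.f₂₄ = F.map e.inv.τ₂ ≫ F.map Q.f₂₄ ≫ F.map e.hom.τ₄ := by
      rw [← reassoc_of% c₂₄, t₄, Category.comp_id]
    change Etale (F.map Q'.f₂₄)
    rw [this]
    infer_instance
  · obtain ⟨r, hr, _⟩ := h.isIso_complement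
    obtain ⟨s, hs, _⟩ := exists_iso_complement _ _ _ _ c₁₂
    obtain ⟨t, ht, _⟩ := exists_iso_complement _ _ _ _ d₃₄
    refine ⟨s ≫ r ≫ t, ?_, inferInstance⟩
    rw [Category.assoc, Category.assoc, ht, reassoc_of% hr, reassoc_of% hs]
    change _ ≫ F.map e.inv.τ₂ ≫ F.map Q.f₂₄ ≫ F.map e.hom.τ₄ = _ ≫ F.map Q'.f₂₄
    rw [← reassoc_of% c₂₄, t₄, Category.comp_id]

/-- The equivariant Nisnevich cd-structure on the category of `G`-schemes. -/
noncomputable def nisnevichCD : CDStructure (GSch G) where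
  Distinguished := IsDistinguished G
  of_iso e h := h.of_iso G e

/-- The equivariant Nisnevich topology. -/
noncomputable def nisnevichTopology : GrothendieckTopology (GSch G) := (nisnevichCD G).topology

end EquivariantNisnevich

open EquivariantNisnevich

/-! ### Monoid actions described on generalized points, and actions on fibre products. -/

section ModPullback

open MonoidalCategory CartesianMonoidalCategory CategoryTheory.MonObj

namespace CategoryTheory

variable {C : Type u} [Category.{v} C] [CartesianMonoidalCategory C] {M : C} [MonObj M]

/-! Everything rests on one reformulation. A cartesian square with `A ⟶ X` an open immersion and `p
: Y ⟶ X` étale is distinguished iff `p` becomes an isomorphism after base change to any reduced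
scheme mapping into `X ∖ A` (`isIsoOutside_iff`). Unlike a condition on reduced complements, this
visibly survives base change, so the cd-structure is stable. Tested on residue fields, it shows that
every point of `Y ×_X Y` over `X ∖ A` lies on the diagonal. As the diagonal of an étale morphism is
open, the diagonal and `B ×_A B ⟶ Y ×_X Y` form a distinguished square again
(`IsDistinguished.diagonalSquare`).

Stability makes the sieves containing a simple covering into a topology, with all sieves allowed on
the empty scheme; this is completeness. The diagonal square says that `Y` and `B ×_A B` cover `Y ×_X
Y`, which gives regularity and shows that sheaves turn distinguished squares into cartesian ones;
the converse follows from stability. The same gluing works for morphisms of schemes, which form fppf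
sheaves, and equivariance of a glued morphism is checked on the cover of `G ×_S X` by `G ×_S Y` and
`G ×_S A`. Hence the topology is subcanonical.

For boundedness, `D_i` consists of the open immersions whose complement has codimension at least
`i`. Every distinguished square is reducing (`isReducing_codimDensity`): one removes from `X` a
closed set of bad points. Étale morphisms do not lower codimension, and a point of the closure of `B
∖ B₀` in `Y` lying outside `B` is a proper specialization, which turns codimension `i` into `i + 1`.
Flatness of `G` keeps closures of invariant sets invariant, so that the open sets used carry
actions.

The vanishing is Voevodsky's argument: by induction on `i`, a class of degree `i` dies on some
element of `D_i(X)`. A class of positive degree dies on a simple covering, and Mayer–Vietoris with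
reducing squares turns this into vanishing on a single dense open. For `i > dim X` that open is `X`
itself. -/

theorem ModObj.smul_eq_fst_smul_snd (X : C) [ModObj M X] :
    γ[M, X] = fst M X • snd M X := by
  simp [Hom.smul_def]

theorem IsModHom.of_fst_smul_snd {X Y : C} [ModObj M X] [ModObj M Y] (f : X ⟶ Y)
    (h : (fst M X • snd M X) ≫ f = fst M X • (snd M X ≫ f)) : IsModHom M f where
  smul_hom := by
    rw [ModObj.smul_eq_fst_smul_snd, h, Hom.smul_def]
    congr 1
    ext <;> simp

/-- An action of a monoid object, given by its effect on generalized points. -/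
@[reducible] def ModObj.ofPoints {X : C} (s : M ⊗ X ⟶ X)
    (one : ∀ (Z : C) (x : Z ⟶ X), lift (1 : Z ⟶ M) x ≫ s = x)
    (mul : ∀ (Z : C) (m n : Z ⟶ M) (x : Z ⟶ X),
      lift (m * n) x ≫ s = lift m (lift n x ≫ s) ≫ s) : ModObj M X where
  smul := s
  one_smul := by
    -- The action axioms are the pointwise identities at the universal points, here and in
    -- `mul_smul` below.
    have := one (𝟙_ C ⊗ X) (snd _ _)
    rw [Hom.one_def] at this
    change η ▷ X ≫ s = (λ_ X).hom
    rw [leftUnitor_hom]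
    refine Eq.trans ?_ this
    congr 1
    ext <;> simp [toUnit_unique (fst (𝟙_ C) X) (toUnit _)]
  mul_smul := by
    have := mul ((M ⊗ M) ⊗ X) (fst _ _ ≫ fst _ _) (fst _ _ ≫ snd _ _) (snd _ _)
    rw [Hom.mul_def] at this
    change μ ▷ X ≫ s = (α_ M M X).hom ≫ M ◁ s ≫ s
    refine Eq.trans ?_ (this.trans ?_)
    · congr 1
      ext <;> simp
    · simp only [← Category.assoc]
      congr 1
      ext
      · simp
      · simp only [Category.assoc, lift_snd, whiskerLeft_snd]
        rw [← Category.assoc]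
        congr 1
        ext <;> simp

variable {P X Y Z : C} [ModObj M X] [ModObj M Y] {p : P ⟶ X} {q : P ⟶ Y} {f : X ⟶ Z} {g : Y ⟶ Z}

/-- The action of a monoid object on a fibre product of objects with an action. -/
@[reducible] noncomputable def ModObj.ofIsPullback [ModObj M Z] [IsModHom M f] [IsModHom M g]
    (h : IsPullback p q f g) : ModObj M P :=
  have hw : (fst M P • (snd M P ≫ p)) ≫ f = (fst M P • (snd M P ≫ q)) ≫ g := by
    rw [IsModHom.map_smul, IsModHom.map_smul, Category.assoc, Category.assoc, h.w]
  have hp (T : C) (m : T ⟶ M) (x : T ⟶ P) :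
      lift m x ≫ h.lift _ _ hw ≫ p = m • (x ≫ p) := by
    rw [h.lift_fst, ModObj.comp_smul]; simp
  have hq (T : C) (m : T ⟶ M) (x : T ⟶ P) :
      lift m x ≫ h.lift _ _ hw ≫ q = m • (x ≫ q) := by
    rw [h.lift_snd, ModObj.comp_smul]; simp
  .ofPoints (h.lift (fst M P • (snd M P ≫ p)) (fst M P • (snd M P ≫ q)) hw)
    (fun T x ↦ by apply h.hom_ext <;> simp [hp, hq, -IsPullback.lift_fst, -IsPullback.lift_snd])
    (fun T m n x ↦ by
      apply h.hom_ext <;>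
        simp [hp, hq, SemigroupAction.mul_smul, -IsPullback.lift_fst, -IsPullback.lift_snd])

theorem IsModHom.fst_ofIsPullback [ModObj M Z] [IsModHom M f] [IsModHom M g] (h : IsPullback p q f g) :
    letI := ModObj.ofIsPullback (M := M) h
    IsModHom M p :=
  letI := ModObj.ofIsPullback (M := M) h
  .of_fst_smul_snd _ (by rw [← ModObj.smul_eq_fst_smul_snd]; exact h.lift_fst _ _ _)

theorem IsModHom.snd_ofIsPullback [ModObj M Z] [IsModHom M f] [IsModHom M g] (h : IsPullback p q f g) :
    letI := ModObj.ofIsPullback (M := M) h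
    IsModHom M q :=
  letI := ModObj.ofIsPullback (M := M) h
  .of_fst_smul_snd _ (by rw [← ModObj.smul_eq_fst_smul_snd]; exact h.lift_snd _ _ _)

theorem IsModHom.of_isPullback [ModObj M P] {W : C} [ModObj M W] (h : IsPullback p q f g)
    [IsModHom M p] [IsModHom M q] (k : W ⟶ P)
    [IsModHom M (k ≫ p)] [IsModHom M (k ≫ q)] : IsModHom M k :=
  .of_fst_smul_snd _ (by apply h.hom_ext <;> simp)

end CategoryTheory
end ModPullback

instance {C : Type u} [Category.{v} C] [MonoidalCategory C] (M : C) [MonObj M] :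
    (CategoryTheory.Mod.forget (D := C) M).Faithful where
  map_injective h := CategoryTheory.Mod.hom_ext _ _ h

/-! ### Fibre products of `G`-schemes. -/

namespace EquivariantNisnevich

section GSchPullback

variable {S : Scheme.{u}} {G : Over S} [GrpObj G]

instance : (GSch.forget G).Faithful := by
  unfold GSch.forget; infer_instance

/-- The underlying morphism over `S` of a morphism of `G`-schemes. -/
noncomputable abbrev GSch.over {X Y : GSch G} (f : X ⟶ Y) : X.obj.X ⟶ Y.obj.X := f.hom.hom

instance {X Y : GSch G} (f : X ⟶ Y) : IsModHom G (GSch.over f) := f.hom.isModHom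

/-- A morphism of `G`-schemes from an equivariant morphism over `S`. -/
noncomputable abbrev GSch.homMk {X Y : GSch G} (f : X.obj.X ⟶ Y.obj.X) [IsModHom G f] : X ⟶ Y :=
  ObjectProperty.homMk (CategoryTheory.Mod.Hom.mk f)

theorem GSch.hom_ext {X Y : GSch G} {f g : X ⟶ Y}
    (h : (GSch.forget G).map f = (GSch.forget G).map g) : f = g :=
  (GSch.forget G).map_injective h

instance : (GSch.forget G).ReflectsIsomorphisms where
  reflects {X Y} f hf := by
    have : IsIso ((Over.forget S).map (GSch.over f)) := hf
    have : IsIso (GSch.over f) := isIso_of_reflects_iso _ (Over.forget S)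
    have : IsModHom G (asIso (GSch.over f)).hom := inferInstanceAs (IsModHom G (GSch.over f))
    have : IsModHom G (inv (GSch.over f)) :=
      inferInstanceAs (IsModHom G (asIso (GSch.over f)).inv)
    refine ⟨GSch.homMk (inv (GSch.over f)), ?_, ?_⟩
    · ext; simp
    · ext; simp

/-- The structure morphism of a `G`-scheme. -/
noncomputable def GSch.toBase (X : GSch G) : (GSch.forget G).obj X ⟶ S := X.obj.X.hom

instance (X : GSch G) : IsSeparated X.toBase := X.property.1

instance (X : GSch G) : LocallyOfFiniteType X.toBase := X.property.2.1

instance (X : GSch G) : QuasiCompact X.toBase := X.property.2.2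

theorem GSch.map_toBase {X Y : GSch G} (f : X ⟶ Y) :
    (GSch.forget G).map f ≫ Y.toBase = X.toBase := Over.w (GSch.over f)

instance GSch.isSeparated_map {X Y : GSch G} (f : X ⟶ Y) :
    IsSeparated ((GSch.forget G).map f) := by
  have : IsSeparated ((GSch.forget G).map f ≫ Y.toBase) := by
    rw [GSch.map_toBase]; infer_instance
  exact .of_comp _ Y.toBase

instance GSch.locallyOfFiniteType_map {X Y : GSch G} (f : X ⟶ Y) :
    LocallyOfFiniteType ((GSch.forget G).map f) := by
  have : LocallyOfFiniteType ((GSch.forget G).map f ≫ Y.toBase) := by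
    rw [GSch.map_toBase]; infer_instance
  exact locallyOfFiniteType_of_comp _ Y.toBase

instance GSch.quasiCompact_map {X Y : GSch G} (f : X ⟶ Y) :
    QuasiCompact ((GSch.forget G).map f) := by
  have : QuasiCompact ((GSch.forget G).map f ≫ Y.toBase) := by
    rw [GSch.map_toBase]; infer_instance
  exact .of_comp _ Y.toBase

/-- The fibre product of the underlying schemes carries the componentwise action. It stays separated
of finite type over `S` because its projection to `X` is a base change of `g`. Recording both
cartesian squares shows at once that the forgetful functor preserves pullbacks. -/
theorem GSch.exists_isPullback {X Y Z : GSch G} (f : X ⟶ Z) (g : Y ⟶ Z) :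
    ∃ (P : GSch G) (p : P ⟶ X) (q : P ⟶ Y), IsPullback p q f g ∧
      IsPullback ((GSch.forget G).map p) ((GSch.forget G).map q) ((GSch.forget G).map f)
        ((GSch.forget G).map g) := by
  have h := IsPullback.of_hasPullback (GSch.over f) (GSch.over g)
  let m := ModObj.ofIsPullback (M := G) h
  have : IsModHom G (pullback.fst (GSch.over f) (GSch.over g)) := IsModHom.fst_ofIsPullback h
  have : IsModHom G (pullback.snd (GSch.over f) (GSch.over g)) := IsModHom.snd_ofIsPullback h
  have hS := h.map (Over.forget S)
  let P : GSch G :=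
    { obj := ⟨pullback (GSch.over f) (GSch.over g)⟩
      property := by
        obtain ⟨h₁, h₂, h₃⟩ := X.property
        have : IsSeparated (pullback.fst (GSch.over f) (GSch.over g)).left :=
          MorphismProperty.of_isPullback hS.flip (GSch.isSeparated_map g)
        have : LocallyOfFiniteType (pullback.fst (GSch.over f) (GSch.over g)).left :=
          MorphismProperty.of_isPullback hS.flip (GSch.locallyOfFiniteType_map g)
        have : QuasiCompact (pullback.fst (GSch.over f) (GSch.over g)).left :=
          MorphismProperty.of_isPullback hS.flip (GSch.quasiCompact_map g)
        dsimp only [IsSchemeOver]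
        rw [← Over.w (pullback.fst (GSch.over f) (GSch.over g))]
        exact ⟨inferInstance, inferInstance, inferInstance⟩ }
  refine ⟨P, GSch.homMk (X := P) (pullback.fst _ _), GSch.homMk (X := P) (pullback.snd _ _),
    ⟨⟨?_⟩, ⟨PullbackCone.IsLimit.mk _ (fun s ↦ ?_) (fun s ↦ ?_) (fun s ↦ ?_) ?_⟩⟩, hS⟩
  · ext1; ext1; exact h.w
  · have hs : GSch.over s.fst ≫ GSch.over f = GSch.over s.snd ≫ GSch.over g :=
      congr_arg GSch.over s.condition
    have : IsModHom G (h.lift _ _ hs ≫ pullback.fst (GSch.over f) (GSch.over g)) := by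
      rw [h.lift_fst]; infer_instance
    have : IsModHom G (h.lift _ _ hs ≫ pullback.snd (GSch.over f) (GSch.over g)) := by
      rw [h.lift_snd]; infer_instance
    have := IsModHom.of_isPullback (M := G) h (h.lift _ _ hs)
    exact GSch.homMk (Y := P) (h.lift _ _ hs)
  · ext1; ext1
    exact h.lift_fst _ _ _
  · ext1; ext1
    exact h.lift_snd _ _ _
  · intro s m h₁ h₂
    ext1; ext1
    apply h.hom_ext
    · exact (congr_arg GSch.over h₁).trans (h.lift_fst _ _ _).symm
    · exact (congr_arg GSch.over h₂).trans (h.lift_snd _ _ _).symm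

instance : HasPullbacks (GSch G) :=
  have {X Y Z : GSch G} (f : X ⟶ Z) (g : Y ⟶ Z) : HasPullback f g := by
    obtain ⟨P, p, q, h, -⟩ := GSch.exists_isPullback f g
    exact h.hasPullback
  hasPullbacks_of_hasLimit_cospan _

instance {X Y Z : GSch G} (f : X ⟶ Z) (g : Y ⟶ Z) :
    PreservesLimit (cospan f g) (GSch.forget G) := by
  obtain ⟨P, p, q, h, h'⟩ := GSch.exists_isPullback f g
  exact preservesLimit_of_preserves_limit_cone h.isLimit
    ((isLimitMapConePullbackConeEquiv (GSch.forget G) h.w).symm h'.isLimit)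

end GSchPullback

end EquivariantNisnevich

/-! ### Sieves generated by two arrows, and the sheaf condition for a square. -/

namespace CategoryTheory

variable {C : Type u} [Category.{v} C]

theorem Sieve.mem_ofTwoArrows_iff {U V X W : C} (i : U ⟶ X) (j : V ⟶ X) (g : W ⟶ X) :
    Sieve.ofTwoArrows i j g ↔ (∃ h : W ⟶ U, h ≫ i = g) ∨ ∃ h : W ⟶ V, h ≫ j = g := by
  rw [Sieve.mem_ofArrows_iff]
  constructor
  · rintro ⟨_ | _, h, rfl⟩
    · exact .inl ⟨h, rfl⟩
    · exact .inr ⟨h, rfl⟩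
  · rintro (⟨h, rfl⟩ | ⟨h, rfl⟩)
    · exact ⟨.left, h, rfl⟩
    · exact ⟨.right, h, rfl⟩

theorem Sieve.pullback_ofTwoArrows {U V X X' : C} (i : U ⟶ X) (j : V ⟶ X) (f : X' ⟶ X)
    [HasPullback i f] [HasPullback j f] :
    (Sieve.ofTwoArrows i j).pullback f =
      Sieve.ofTwoArrows (pullback.snd i f) (pullback.snd j f) := by
  ext Z g
  refine (Sieve.mem_ofTwoArrows_iff _ _ (g ≫ f)).trans (Iff.trans ?_
    (Sieve.mem_ofTwoArrows_iff _ _ g).symm)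
  refine or_congr ⟨?_, ?_⟩ ⟨?_, ?_⟩
  · rintro ⟨h, hh⟩
    exact ⟨pullback.lift h g hh, pullback.lift_snd _ _ _⟩
  · rintro ⟨h, rfl⟩
    exact ⟨h ≫ pullback.fst _ _, by simp [pullback.condition]⟩
  · rintro ⟨h, hh⟩
    exact ⟨pullback.lift h g hh, pullback.lift_snd _ _ _⟩
  · rintro ⟨h, rfl⟩
    exact ⟨h ≫ pullback.fst _ _, by simp [pullback.condition]⟩

theorem Presieve.isSheafFor_ofTwoArrows_iff {U V X : C} (i : U ⟶ X) (j : V ⟶ X)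
    (F : Cᵒᵖ ⥤ Type w) :
    Presieve.IsSheafFor F (Sieve.ofTwoArrows i j).arrows ↔
      ∀ (y : F.obj (op U)) (a : F.obj (op V)),
        (∀ (Z : C) (g g' : Z ⟶ U), g ≫ i = g' ≫ i → F.map g.op y = F.map g'.op y) →
        (∀ (Z : C) (g g' : Z ⟶ V), g ≫ j = g' ≫ j → F.map g.op a = F.map g'.op a) →
        (∀ (Z : C) (g : Z ⟶ U) (g' : Z ⟶ V), g ≫ i = g' ≫ j →
          F.map g.op y = F.map g'.op a) →
        ∃! x : F.obj (op X), F.map i.op x = y ∧ F.map j.op x = a := by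
  dsimp only [Sieve.ofTwoArrows, Sieve.ofArrows]
  rw [← Presieve.isSheafFor_iff_generate, Presieve.isSheafFor_arrows_iff]
  constructor
  · intro H y a h₁ h₂ h₃
    obtain ⟨x, hx, hx'⟩ := H (fun k ↦ match k with | .left => y | .right => a) (by
      rintro (_ | _) (_ | _) Z g g' hg
      · exact h₁ _ _ _ hg
      · exact h₃ _ _ _ hg
      · exact (h₃ _ _ _ hg.symm).symm
      · exact h₂ _ _ _ hg)
    refine ⟨x, ⟨hx .left, hx .right⟩, fun x' h ↦ hx' _ ?_⟩
    rintro (_ | _)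
    exacts [h.1, h.2]
  · intro H x hx
    obtain ⟨t, ht, ht'⟩ := H (x .left) (x .right) (fun Z g g' ↦ hx .left .left Z g g')
      (fun Z g g' ↦ hx .right .right Z g g') (fun Z g g' ↦ hx .left .right Z g g')
    refine ⟨t, ?_, fun t' h ↦ ht' _ ⟨h .left, h .right⟩⟩
    rintro (_ | _)
    exacts [ht.1, ht.2]

theorem Presieve.isSeparatedFor_ofTwoArrows {U V X : C} {i : U ⟶ X} {j : V ⟶ X}
    {F : Cᵒᵖ ⥤ Type w} (H : Presieve.IsSeparatedFor F (Sieve.ofTwoArrows i j).arrows)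
    {s t : F.obj (op X)} (h₁ : F.map i.op s = F.map i.op t) (h₂ : F.map j.op s = F.map j.op t) :
    s = t := by
  apply H.ext
  intro Y f hf
  obtain ⟨h, rfl⟩ | ⟨h, rfl⟩ := (Sieve.mem_ofTwoArrows_iff _ _ _).1 hf
  · rw [op_comp, Functor.map_comp_apply, Functor.map_comp_apply, h₁]
  · rw [op_comp, Functor.map_comp_apply, Functor.map_comp_apply, h₂]

namespace Square

theorem op_map_isPullback_iff (Q : Square C) (F : Cᵒᵖ ⥤ Type w) :
    (Q.op.map F).IsPullback ↔
      ∀ (y : F.obj (op Q.X₂)) (a : F.obj (op Q.X₃)), F.map Q.f₁₂.op y = F.map Q.f₁₃.op a →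
        ∃! x : F.obj (op Q.X₄), F.map Q.f₂₄.op x = y ∧ F.map Q.f₃₄.op x = a := by
  have : (Q.op.map F).IsPullback ↔ CategoryTheory.IsPullback (F.map Q.f₂₄.op) (F.map Q.f₃₄.op)
      (F.map Q.f₁₂.op) (F.map Q.f₁₃.op) := Iff.rfl
  rw [this, Types.isPullback_iff]
  constructor
  · rintro ⟨-, h₁, h₂⟩ y a hya
    obtain ⟨x, hx⟩ := h₂ y a hya
    exact ⟨x, hx, fun x' hx' ↦ h₁ _ _ ⟨hx'.1.trans hx.1.symm, hx'.2.trans hx.2.symm⟩⟩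
  · intro H
    refine ⟨by rw [← F.map_comp, ← F.map_comp, ← op_comp, ← op_comp, Q.fac], ?_, ?_⟩
    · rintro x x' ⟨h₁, h₂⟩
      refine (H (F.map Q.f₂₄.op x') (F.map Q.f₃₄.op x') ?_).unique ⟨h₁, h₂⟩ ⟨rfl, rfl⟩
      rw [← Functor.map_comp_apply, ← Functor.map_comp_apply, ← op_comp, ← op_comp, Q.fac]
    · intro y a h
      exact (H y a h).exists

/-- A matching pair over `X₂` and `X₃` agrees in particular on `X₁`, so the cartesian square glues
it uniquely. -/
theorem isSheafFor_ofTwoArrows {Q : Square C} {F : Cᵒᵖ ⥤ Type w} (h : (Q.op.map F).IsPullback) :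
    Presieve.IsSheafFor F (Sieve.ofTwoArrows Q.f₂₄ Q.f₃₄).arrows := by
  rw [Presieve.isSheafFor_ofTwoArrows_iff]
  intro y a _ _ H
  exact (op_map_isPullback_iff _ _).1 h y a (H _ _ _ Q.fac)

section Pullbacks

variable [HasPullbacks C]

/-- The morphism from `X₁ ×_{X₃} X₁` to `X₂ ×_{X₄} X₂`. -/
noncomputable def relativeMap (Q : Square C) : pullback Q.f₁₃ Q.f₁₃ ⟶ pullback Q.f₂₄ Q.f₂₄ :=
  pullback.map _ _ _ _ Q.f₁₂ Q.f₁₂ Q.f₃₄ Q.fac.symm Q.fac.symm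

@[simp]
theorem relativeMap_fst (Q : Square C) :
    Q.relativeMap ≫ pullback.fst _ _ = pullback.fst _ _ ≫ Q.f₁₂ :=
  pullback.lift_fst _ _ _

@[simp]
theorem relativeMap_snd (Q : Square C) :
    Q.relativeMap ≫ pullback.snd _ _ = pullback.snd _ _ ≫ Q.f₁₂ :=
  pullback.lift_snd _ _ _

/-- The square with lower side the diagonal `X₂ ⟶ X₂ ×_{X₄} X₂` and right side the morphism
`X₁ ×_{X₃} X₁ ⟶ X₂ ×_{X₄} X₂`. -/
noncomputable def diagonalSquare (Q : Square C) : Square C where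
  X₁ := pullback Q.relativeMap (pullback.diagonal Q.f₂₄)
  X₂ := pullback Q.f₁₃ Q.f₁₃
  X₃ := Q.X₂
  X₄ := pullback Q.f₂₄ Q.f₂₄
  f₁₂ := pullback.fst _ _
  f₁₃ := pullback.snd _ _
  f₂₄ := Q.relativeMap
  f₃₄ := pullback.diagonal Q.f₂₄
  fac := pullback.condition

theorem diagonalSquare_isPullback (Q : Square C) : Q.diagonalSquare.IsPullback :=
  IsPullback.of_hasPullback _ _

/-- Sections `y`, `a` agreeing on `X₁` must be shown to match on the whole sieve. The only
nontrivial point is that both pullbacks of `y` to `X₂ ×_{X₄} X₂` agree. They agree trivially on the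
diagonal, and on `X₁ ×_{X₃} X₁` both are restrictions of `a`; separatedness for these two arrows
concludes. -/
theorem op_map_isPullback_of_isSheafFor {Q : Square C} {F : Cᵒᵖ ⥤ Type w} (hQ : Q.IsPullback)
    [Mono Q.f₃₄] (h : Presieve.IsSheafFor F (Sieve.ofTwoArrows Q.f₂₄ Q.f₃₄).arrows)
    (h' : Presieve.IsSeparatedFor F
      (Sieve.ofTwoArrows Q.relativeMap (pullback.diagonal Q.f₂₄)).arrows) :
    (Q.op.map F).IsPullback := by
  rw [op_map_isPullback_iff]
  intro y a hya
  rw [Presieve.isSheafFor_ofTwoArrows_iff] at h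
  have hya' (Z : C) (g : Z ⟶ Q.X₂) (g' : Z ⟶ Q.X₃) (hg : g ≫ Q.f₂₄ = g' ≫ Q.f₃₄) :
      F.map g.op y = F.map g'.op a := by
    obtain ⟨l, rfl, rfl⟩ := CategoryTheory.IsPullback.exists_lift hQ g g' hg
    rw [op_comp, Functor.map_comp_apply, hya, op_comp, Functor.map_comp_apply]
  refine h y a ?_ ?_ hya'
  · intro Z g g' hg
    have : F.map (pullback.fst Q.f₂₄ Q.f₂₄).op y = F.map (pullback.snd Q.f₂₄ Q.f₂₄).op y := by
      apply Presieve.isSeparatedFor_ofTwoArrows h'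
      · rw [← Functor.map_comp_apply, ← Functor.map_comp_apply, ← op_comp, ← op_comp,
          relativeMap_fst, relativeMap_snd, op_comp, op_comp, Functor.map_comp_apply,
          Functor.map_comp_apply, hya, ← Functor.map_comp_apply, ← Functor.map_comp_apply,
          ← op_comp, ← op_comp, pullback.condition]
      · rw [← Functor.map_comp_apply, ← Functor.map_comp_apply, ← op_comp, ← op_comp,
          pullback.diagonal_fst, pullback.diagonal_snd]
    have := congr_arg (F.map (pullback.lift g g' hg).op) this
    rwa [← Functor.map_comp_apply, ← Functor.map_comp_apply, ← op_comp, ← op_comp,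
      pullback.lift_fst, pullback.lift_snd] at this
  · intro Z g g' hg
    rw [cancel_mono] at hg
    rw [hg]

/-- The base change of a square along a morphism to its lower right corner. -/
noncomputable def baseChange (Q : Square C) {X' : C} (f : X' ⟶ Q.X₄) : Square C where
  X₁ := pullback (Q.f₁₂ ≫ Q.f₂₄) f
  X₂ := pullback Q.f₂₄ f
  X₃ := pullback Q.f₃₄ f
  X₄ := X'
  f₁₂ := pullback.lift (pullback.fst _ _ ≫ Q.f₁₂) (pullback.snd _ _)
    (by rw [Category.assoc, pullback.condition])
  f₁₃ := pullback.lift (pullback.fst _ _ ≫ Q.f₁₃) (pullback.snd _ _)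
    (by rw [Category.assoc, ← Q.fac, pullback.condition])
  f₂₄ := pullback.snd _ _
  f₃₄ := pullback.snd _ _
  fac := by rw [pullback.lift_snd, pullback.lift_snd]

end Pullbacks

end Square

end CategoryTheory

/-! ### Stable cd-structures: sheaf criterion and completeness. -/

namespace EquivariantNisnevich.CDStructure

variable {C : Type u} [Category.{v} C] [HasInitial C] (P : CDStructure C)

theorem ofTwoArrows_mem_topology {Q : Square C} (hQ : P.Distinguished Q) :
    Sieve.ofTwoArrows Q.f₂₄ Q.f₃₄ ∈ P.topology Q.X₄ := by
  rw [topology, GrothendieckTopology.mem_sInf]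
  exact fun J hJ ↦ hJ.1 Q hQ

theorem bot_mem_topology : (⊥ : Sieve (⊥_ C)) ∈ P.topology (⊥_ C) := by
  rw [topology, GrothendieckTopology.mem_sInf]
  exact fun J hJ ↦ hJ.2

variable {P}

theorem topology_le {J : GrothendieckTopology C}
    (h₁ : ∀ Q : Square C, P.Distinguished Q → Sieve.ofTwoArrows Q.f₂₄ Q.f₃₄ ∈ J Q.X₄)
    (h₂ : (⊥ : Sieve (⊥_ C)) ∈ J (⊥_ C)) : P.topology ≤ J :=
  sInf_le ⟨h₁, h₂⟩

theorem unique_of_isSheaf {F : Cᵒᵖ ⥤ Type w} (hF : Presieve.IsSheaf P.topology F) :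
    Nonempty (Unique (F.obj (op (⊥_ C)))) := by
  obtain ⟨x, -, hx⟩ := hF _ P.bot_mem_topology (fun Y f hf ↦ hf.elim) (fun _ _ _ _ _ _ _ h ↦ h.elim)
  exact ⟨⟨⟨x⟩, fun y ↦ hx y fun _ _ h ↦ h.elim⟩⟩

variable [HasPullbacks C]

variable (P) in
/-- A cd-structure is stable if the base change of a distinguished square is distinguished. -/
def IsStable : Prop :=
  ∀ (Q : Square C), P.Distinguished Q → ∀ (X' : C) (f : X' ⟶ Q.X₄),
    P.Distinguished (Q.baseChange f)

/-- The topology is compared with the finest one for which `F` is a sheaf. Membership there asks for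
the sheaf condition on all base changes of the generating sieves; these are again of the same kind
by stability, and by strictness of the initial object. -/
theorem isSheaf_of_isPullback [HasStrictInitialObjects C] (hP : P.IsStable)
    (F : Cᵒᵖ ⥤ Type w) (h₀ : Nonempty (Unique (F.obj (op (⊥_ C)))))
    (hF : ∀ Q : Square C, P.Distinguished Q → (Q.op.map F).IsPullback) :
    Presieve.IsSheaf P.topology F := by
  have : P.topology ≤ Sheaf.finestTopologySingle F := by
    refine topology_le (fun Q hQ X' f ↦ ?_) (fun X' f ↦ ?_)
    · rw [Sieve.pullback_ofTwoArrows]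
      exact Square.isSheafFor_ofTwoArrows (hF _ (hP Q hQ X' f))
    · have : IsIso f := (initialIsInitial).isIso_to f
      obtain ⟨hu⟩ := h₀
      let e := (F.mapIso (asIso f).op).toEquiv
      intro x _
      refine ⟨e default, fun Y g hg ↦ hg.elim, fun y _ ↦ ?_⟩
      exact e.symm.injective (Subsingleton.elim _ _)
  intro X R hR
  simpa using this X hR X (𝟙 X)

theorem isPullback_of_isSheaf {F : Cᵒᵖ ⥤ Type w} (hF : Presieve.IsSheaf P.topology F)
    {Q : Square C} (hQ : P.Distinguished Q) (hQ' : Q.IsPullback) [Mono Q.f₃₄]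
    (h : P.Distinguished Q.diagonalSquare) :
    (Q.op.map F).IsPullback :=
  Square.op_map_isPullback_of_isSheafFor hQ' (hF _ (P.ofTwoArrows_mem_topology hQ))
    (hF _ (P.ofTwoArrows_mem_topology h)).isSeparatedFor

omit [HasPullbacks C] in
theorem SimpleCovering.nonempty {X : C} {T : Presieve X} (hT : P.SimpleCovering X T) :
    ∃ (Y : C) (f : Y ⟶ X), T f := by
  induction hT with
  | of_isIso f hf => exact ⟨_, f, ⟨⟩⟩
  | of_square Q hQ R T hR hT hR' hT' =>
    obtain ⟨Y, f, hf⟩ := hR'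
    exact ⟨Y, _, .inl ⟨f, hf, rfl⟩⟩

/-- Induction on the covering: base change the outermost square, and pull back the coverings of its
two upper corners along the projections. -/
theorem SimpleCovering.exists_pullback (hP : P.IsStable) {X : C} {T : Presieve X}
    (hT : P.SimpleCovering X T) {X' : C} (f : X' ⟶ X) :
    ∃ T' : Presieve X', P.SimpleCovering X' T' ∧ T' ≤ ((Sieve.generate T).pullback f).arrows := by
  induction hT generalizing X' with
  | @of_isIso X'' X f₀ hf₀ =>
    refine ⟨_, .of_isIso (𝟙 X') inferInstance, ?_⟩
    rintro _ _ ⟨⟩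
    exact ⟨_, f ≫ inv f₀, f₀, ⟨⟩, by simp⟩
  | of_square Q hQ R T hR hT hR' hT' =>
    obtain ⟨R', hR', hRR'⟩ := hR' (pullback.fst Q.f₂₄ f)
    obtain ⟨T', hT', hTT'⟩ := hT' (pullback.fst Q.f₃₄ f)
    refine ⟨_, .of_square _ (hP Q hQ X' f) _ _ hR' hT', ?_⟩
    rintro Z g (⟨(h : Z ⟶ pullback Q.f₂₄ f), hh, rfl⟩ | ⟨(h : Z ⟶ pullback Q.f₃₄ f), hh, rfl⟩)
    · obtain ⟨W, a, b, hb, hab⟩ := hRR' _ _ hh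
      refine ⟨W, a, b ≫ Q.f₂₄, .inl ⟨b, hb, rfl⟩, ?_⟩
      have hw : (h ≫ pullback.fst Q.f₂₄ f) ≫ Q.f₂₄ = (h ≫ pullback.snd Q.f₂₄ f) ≫ f := by
        simp [pullback.condition]
      rw [← Category.assoc, hab]
      exact hw
    · obtain ⟨W, a, b, hb, hab⟩ := hTT' _ _ hh
      refine ⟨W, a, b ≫ Q.f₃₄, .inr ⟨b, hb, rfl⟩, ?_⟩
      have hw : (h ≫ pullback.fst Q.f₃₄ f) ≫ Q.f₃₄ = (h ≫ pullback.snd Q.f₃₄ f) ≫ f := by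
        simp [pullback.condition]
      rw [← Category.assoc, hab]
      exact hw

variable (P) in
/-- A sieve is simply covering if it contains a simple covering, or if it is a sieve on the initial
object. -/
def IsSimplyCovering {X : C} (R : Sieve X) : Prop :=
  Nonempty (X ≅ ⊥_ C) ∨ ∃ T : Presieve X, P.SimpleCovering X T ∧ T ≤ R.arrows

omit [HasPullbacks C] in
-- A nonempty sieve on an initial object is maximal, so for nonempty sieves the exceptional clause
-- about the initial object is superfluous.
theorem IsSimplyCovering.exists_le {X : C} {R : Sieve X} (hR : P.IsSimplyCovering R) {Z : C}
    {g : Z ⟶ X} (hg : R g) : ∃ T : Presieve X, P.SimpleCovering X T ∧ T ≤ R.arrows := by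
  obtain ⟨⟨e⟩⟩ | h := hR
  · refine ⟨_, .of_isIso (𝟙 X) inferInstance, ?_⟩
    rintro _ _ ⟨⟩
    rw [show 𝟙 X = (e.hom ≫ initial.to Z) ≫ g by
      rw [← cancel_epi e.inv]; exact initialIsInitial.hom_ext _ _]
    exact R.downward_closed hg _
  · exact h

theorem IsSimplyCovering.pullback [HasStrictInitialObjects C] (hP : P.IsStable) {X X' : C}
    {R : Sieve X} (hR : P.IsSimplyCovering R) (f : X' ⟶ X) :
    P.IsSimplyCovering (R.pullback f) := by
  obtain ⟨⟨e⟩⟩ | ⟨T, hT, hTR⟩ := hR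
  · have := initialIsInitial.isIso_to (f ≫ e.hom)
    exact .inl ⟨asIso (f ≫ e.hom)⟩
  · obtain ⟨T', hT', h⟩ := hT.exists_pullback hP f
    exact .inr ⟨T', hT', h.trans
      (Sieve.pullback_monotone f ((Sieve.generate_le_iff _ _).2 hTR))⟩

/-- Simple coverings are closed under composition by construction; the care goes into the
exceptional clause. The hypothesis `hP'` handles a square whose two covering corners are initial. -/
theorem IsSimplyCovering.trans (hP : P.IsStable)
    (hP' : ∀ Q : Square C, P.Distinguished Q → Nonempty (Q.X₂ ≅ ⊥_ C) →
      Nonempty (Q.X₃ ≅ ⊥_ C) → Nonempty (Q.X₄ ≅ ⊥_ C))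
    {X : C} {T : Presieve X} (hT : P.SimpleCovering X T) {R : Sieve X}
    (hR : ∀ ⦃Y : C⦄ (f : Y ⟶ X), T f → P.IsSimplyCovering (R.pullback f)) :
    P.IsSimplyCovering R := by
  induction hT with
  | @of_isIso X'' X f₀ hf₀ =>
    obtain ⟨⟨e⟩⟩ | ⟨T, hT, hTR⟩ := hR f₀ ⟨⟩
    · exact .inl ⟨(asIso f₀).symm ≪≫ e⟩
    · obtain ⟨T', hT', h⟩ := hT.exists_pullback hP (inv f₀)
      refine .inr ⟨T', hT', fun Y g hg ↦ ?_⟩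
      obtain ⟨W, a, b, hb, hab⟩ := h _ _ hg
      have : R ((a ≫ b) ≫ f₀) := by
        rw [Category.assoc]
        exact R.downward_closed (hTR _ _ hb) a
      rwa [hab, Category.assoc, IsIso.inv_hom_id, Category.comp_id] at this
  | of_square Q hQ R₀ T₀ hR₀ hT₀ hR₀' hT₀' =>
    have h₂ : P.IsSimplyCovering (R.pullback Q.f₂₄) := hR₀' fun Y f hf ↦ by
      rw [← Sieve.pullback_comp]
      exact hR _ (.inl ⟨f, hf, rfl⟩)
    have h₃ : P.IsSimplyCovering (R.pullback Q.f₃₄) := hT₀' fun Y f hf ↦ by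
      rw [← Sieve.pullback_comp]
      exact hR _ (.inr ⟨f, hf, rfl⟩)
    -- If `R` is nonempty it contains the arrow from the initial object, so its pullbacks are
    -- nonempty and contain honest simple coverings. If `R` is empty, its pullbacks contain none,
    -- since simple coverings are nonempty; so both corners are initial.
    by_cases hne : ∃ (Z : C) (g : Z ⟶ Q.X₄), R g
    · obtain ⟨Z, g, hg⟩ := hne
      have h₀ : R (initial.to Q.X₄) := by
        rw [← initialIsInitial.hom_ext (initial.to Z ≫ g) (initial.to Q.X₄)]
        exact R.downward_closed hg _
      have h₀' {Y : C} (f : Y ⟶ Q.X₄) : R.pullback f (initial.to Y) := by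
        rw [Sieve.pullback_apply, initialIsInitial.hom_ext (initial.to Y ≫ f) (initial.to Q.X₄)]
        exact h₀
      obtain ⟨T₂, hT₂, hT₂'⟩ := h₂.exists_le (h₀' _)
      obtain ⟨T₃, hT₃, hT₃'⟩ := h₃.exists_le (h₀' _)
      refine .inr ⟨_, .of_square Q hQ _ _ hT₂ hT₃, ?_⟩
      rintro Z g (⟨h, hh, rfl⟩ | ⟨h, hh, rfl⟩)
      · exact hT₂' _ _ hh
      · exact hT₃' _ _ hh
    · have key {Y : C} {f : Y ⟶ Q.X₄} (h : P.IsSimplyCovering (R.pullback f)) :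
          Nonempty (Y ≅ ⊥_ C) := by
        obtain h | ⟨T, hT, hTR⟩ := h
        · exact h
        · obtain ⟨Z, g, hg⟩ := hT.nonempty
          exact (hne ⟨Z, _, hTR _ _ hg⟩).elim
      exact .inl (hP' Q hQ (key h₂) (key h₃))

/-- The topology of simply covering sieves. -/
def simpleTopology [HasStrictInitialObjects C] (hP : P.IsStable)
    (hP' : ∀ Q : Square C, P.Distinguished Q → Nonempty (Q.X₂ ≅ ⊥_ C) →
      Nonempty (Q.X₃ ≅ ⊥_ C) → Nonempty (Q.X₄ ≅ ⊥_ C)) : GrothendieckTopology C where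
  sieves X := { R | P.IsSimplyCovering R }
  top_mem' X := .inr ⟨_, .of_isIso (𝟙 X) inferInstance, fun _ _ _ ↦ trivial⟩
  pullback_stable' X Y R f hR := hR.pullback hP f
  transitive' X R hR R' h := by
    obtain hX | ⟨T, hT, hTR⟩ := hR
    · exact .inl hX
    · exact .trans hP hP' hT fun Y f hf ↦ h (hTR _ _ hf)

theorem isComplete_of_isStable [HasStrictInitialObjects C] (hP : P.IsStable)
    (hP' : ∀ Q : Square C, P.Distinguished Q → Nonempty (Q.X₂ ≅ ⊥_ C) →
      Nonempty (Q.X₃ ≅ ⊥_ C) → Nonempty (Q.X₄ ≅ ⊥_ C)) : P.IsComplete := by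
  intro X hX R hR
  have : P.topology ≤ simpleTopology hP hP' := by
    refine topology_le (fun Q hQ ↦ .inr ⟨_, .of_square Q hQ _ _ (.of_isIso (𝟙 _) inferInstance)
      (.of_isIso (𝟙 _) inferInstance), ?_⟩) (.inl ⟨Iso.refl _⟩)
    rintro Z g (⟨h, ⟨⟩, rfl⟩ | ⟨h, ⟨⟩, rfl⟩)
    · exact (Sieve.mem_ofTwoArrows_iff _ _ _).2 (.inl ⟨_, rfl⟩)
    · exact (Sieve.mem_ofTwoArrows_iff _ _ _).2 (.inr ⟨_, rfl⟩)
  obtain ⟨⟨e⟩⟩ | ⟨T, hT, hTR⟩ := this X hR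
  · exact hX.elim e
  · exact ⟨T, hT, (Sieve.generate_le_iff _ _).2 hTR⟩

end EquivariantNisnevich.CDStructure

/-! ### Regularity from a covering of `Y ×_X Y`. -/

namespace EquivariantNisnevich

variable {C : Type u} [Category.{v} C]

/-- Morphisms from `ρ(X)` to a sheaf are sections over `X`, and precomposition is restriction; so
this is separatedness of `F`. -/
theorem rho_hom_ext {J : GrothendieckTopology C} [HasSheafify J (Type v)] {U V X : C}
    {i : U ⟶ X} {j : V ⟶ X} (h : Sieve.ofTwoArrows i j ∈ J X) {F : Sheaf J (Type v)}
    {a b : (rho J).obj X ⟶ F} (hi : (rho J).map i ≫ a = (rho J).map i ≫ b)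
    (hj : (rho J).map j ≫ a = (rho J).map j ≫ b) : a = b := by
  have nat {Y : C} (f : Y ⟶ X) (c : (rho J).obj X ⟶ F) :
      yonedaEquiv ((sheafificationAdjunction J (Type v)).homEquiv _ _ ((rho J).map f ≫ c)) =
        F.obj.map f.op (yonedaEquiv ((sheafificationAdjunction J (Type v)).homEquiv _ _ c)) := by
    refine Eq.trans ?_ (yonedaEquiv_naturality _ _).symm
    congr 1
    exact Adjunction.homEquiv_naturality_left _ _ _
  apply ((sheafificationAdjunction J (Type v)).homEquiv _ _).injective
  apply yonedaEquiv.injective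
  refine Presieve.isSeparatedFor_ofTwoArrows (i := i) (j := j)
    (((isSheaf_iff_isSheaf_of_type _ _).1 F.property) _ h).isSeparatedFor ?_ ?_
  · rw [← nat, ← nat, hi]
  · rw [← nat, ← nat, hj]

/-- Surjective means epi for sheaves. Since `rho` preserves pullbacks, the two components of the map
are the images under `rho` of the diagonal and of `Q.relativeMap`, which are jointly epimorphic
because they generate a covering sieve. -/
theorem isLocallySurjective_diagonalMap [HasPullbacks C] {J : GrothendieckTopology C}
    [HasSheafify J (Type v)] (Q : Square C)
    (h : Sieve.ofTwoArrows Q.relativeMap (pullback.diagonal Q.f₂₄) ∈ J _) :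
    Sheaf.IsLocallySurjective (diagonalMap (Q.map (rho J))) := by
  rw [Sheaf.isLocallySurjective_iff_epi]
  let R := rho J
  let f := R.map Q.f₂₄
  have w : R.map Q.f₁₃ ≫ R.map Q.f₃₄ = R.map Q.f₁₂ ≫ R.map Q.f₂₄ := by
    rw [← R.map_comp, ← R.map_comp, Q.fac]
  let δ : pullback (R.map Q.f₁₃) (R.map Q.f₁₃) ⟶ pullback f f := pullback.map _ _ _ _ _ _ _ w w
  let e : R.obj (pullback Q.f₂₄ Q.f₂₄) ≅ pullback f f := PreservesPullback.iso R Q.f₂₄ Q.f₂₄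
  let e' := PreservesPullback.iso R Q.f₁₃ Q.f₁₃
  have h₁ : R.map (pullback.diagonal Q.f₂₄) ≫ e.hom = pullback.diagonal f := by
    apply pullback.hom_ext
    · simp [e, f, ← Functor.map_comp]
    · simp [e, f, ← Functor.map_comp]
  have δ_fst : δ ≫ pullback.fst f f = pullback.fst _ _ ≫ R.map Q.f₁₂ := pullback.lift_fst _ _ _
  have δ_snd : δ ≫ pullback.snd f f = pullback.snd _ _ ≫ R.map Q.f₁₂ := pullback.lift_snd _ _ _
  have h₂ : R.map Q.relativeMap ≫ e.hom = e'.hom ≫ δ := by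
    apply pullback.hom_ext
    · rw [Category.assoc, Category.assoc, PreservesPullback.iso_hom_fst, δ_fst,
        PreservesPullback.iso_hom_fst_assoc, ← R.map_comp, ← R.map_comp, Square.relativeMap_fst]
    · rw [Category.assoc, Category.assoc, PreservesPullback.iso_hom_snd, δ_snd,
        PreservesPullback.iso_hom_snd_assoc, ← R.map_comp, ← R.map_comp, Square.relativeMap_snd]
  have inl : coprod.inl ≫ diagonalMap (Q.map R) = pullback.diagonal f := coprod.inl_desc _ _
  have inr : coprod.inr ≫ diagonalMap (Q.map R) = δ := coprod.inr_desc _ _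
  refine ⟨fun {F} (a b : pullback f f ⟶ F) hab ↦ ?_⟩
  have hab₁ : pullback.diagonal f ≫ a = pullback.diagonal f ≫ b := by
    rw [← inl]
    exact (Category.assoc _ _ _).trans
      ((congr_arg (coprod.inl ≫ ·) hab).trans (Category.assoc _ _ _).symm)
  have hab₂ : δ ≫ a = δ ≫ b := by
    rw [← inr]
    exact (Category.assoc _ _ _).trans
      ((congr_arg (coprod.inr ≫ ·) hab).trans (Category.assoc _ _ _).symm)
  refine (cancel_epi e.hom).1 (rho_hom_ext h ?_ ?_)
  · change R.map Q.relativeMap ≫ _ = R.map Q.relativeMap ≫ _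
    rw [reassoc_of% h₂, reassoc_of% h₂, hab₂]
  · change R.map (pullback.diagonal Q.f₂₄) ≫ _ = R.map (pullback.diagonal Q.f₂₄) ≫ _
    rw [reassoc_of% h₁, reassoc_of% h₁, hab₁]

end EquivariantNisnevich

/-! ### Morphisms that are isomorphisms outside a subset, tested on reduced schemes. -/

namespace AlgebraicGeometry

variable {X Y : Scheme.{u}}

/-- The zero ideal of a reduced scheme is the vanishing ideal of the whole space, and vanishing
ideals push forward to vanishing ideals of closures. -/
theorem Scheme.Hom.ker_eq_vanishingIdeal [IsReduced X] (f : X ⟶ Y) :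
    f.ker = .vanishingIdeal (.closure (Set.range f)) := by
  rw [← Scheme.IdealSheafData.map_bot, ← Scheme.nilradical_eq_bot,
    ← Scheme.IdealSheafData.vanishingIdeal_top, Scheme.IdealSheafData.map_vanishingIdeal]
  simp

instance isReduced_subscheme_vanishingIdeal (Z : TopologicalSpace.Closeds X) :
    IsReduced (Scheme.IdealSheafData.vanishingIdeal Z).subscheme := by
  have h (U : X.affineOpens) :
      IsReduced ((Scheme.IdealSheafData.vanishingIdeal Z).subschemeCover.openCover.X U) := by
    have : _root_.IsReduced (Γ(X, U) ⧸ (Scheme.IdealSheafData.vanishingIdeal Z).ideal U) := by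
      rw [← Ideal.isRadical_iff_quotient_reduced, Scheme.IdealSheafData.vanishingIdeal_ideal]
      exact PrimeSpectrum.isRadical_vanishingIdeal _
    exact inferInstanceAs (IsReduced (Spec (.of (Γ(X, U) ⧸ _))))
  exact @IsReduced.of_openCover _
    (Scheme.IdealSheafData.vanishingIdeal Z).subschemeCover.openCover h

theorem _root_.CategoryTheory.IsPullback.range_fst_eq {P X Y Z : Scheme.{u}} {p : P ⟶ X}
    {q : P ⟶ Y} {f : X ⟶ Z} {g : Y ⟶ Z} (h : IsPullback p q f g) :
    Set.range p = f ⁻¹' Set.range g := by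
  rw [← Scheme.Pullback.range_fst, ← h.isoPullback_inv_fst, Scheme.Hom.comp_base, TopCat.coe_comp,
    Function.Surjective.range_comp]
  exact (Scheme.homeoOfIso (asIso h.isoPullback.inv)).surjective

/-- A morphism `Y ⟶ X` is an isomorphism outside of a subset `U` of `X` if its base change along
each morphism `T ⟶ X` from a reduced scheme, whose image does not meet `U`, is an isomorphism. -/
def IsIsoOutside (p : Y ⟶ X) (U : Set X) : Prop :=
  ∀ ⦃T : Scheme.{u}⦄ [IsReduced T] (t : T ⟶ X), (∀ a, t a ∉ U) → IsIso (pullback.snd p t)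

namespace IsIsoOutside

variable {p : Y ⟶ X} {U : Set X}

theorem of_isPullback (h : IsIsoOutside p U) {X' Y' : Scheme.{u}} {p' : Y' ⟶ X'} {f : X' ⟶ X}
    {g : Y' ⟶ Y} (hp : IsPullback g p' p f) : IsIsoOutside p' (f ⁻¹' U) := by
  intro T _ t ht
  have := h (t ≫ f) (fun a ↦ by simpa using ht a)
  have h₁ := (IsPullback.of_hasPullback p' t).flip.paste_vert hp.flip
  have h₂ := IsPullback.of_hasPullback p (t ≫ f)
  rw [← h₁.flip.isoPullback_hom_snd]
  infer_instance

theorem existsUnique (h : IsIsoOutside p U) {x : X} (hx : x ∉ U) : ∃! y, p y = x := by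
  -- The test scheme is a single point, so the fibre of `p` over `x` is one as well.
  have := h (X.fromSpecResidueField x) (fun a ↦ by simpa using hx)
  let a : Spec (X.residueField x) := default
  have surj : Function.Surjective (pullback.snd p (X.fromSpecResidueField x)) :=
    (Scheme.homeoOfIso (asIso (pullback.snd p (X.fromSpecResidueField x)))).surjective
  have inj : Function.Injective (pullback.snd p (X.fromSpecResidueField x)) :=
    (Scheme.homeoOfIso (asIso (pullback.snd p (X.fromSpecResidueField x)))).injective
  obtain ⟨b, hb⟩ := surj a
  refine ⟨pullback.fst p (X.fromSpecResidueField x) b, ?_, fun y hy ↦ ?_⟩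
  · dsimp only
    rw [← Scheme.Hom.comp_apply, pullback.condition, Scheme.Hom.comp_apply, hb]
    simp
  · obtain ⟨c, hc, -⟩ := Scheme.Pullback.exists_preimage_pullback (f := p)
      (g := X.fromSpecResidueField x) y a (by simp [hy])
    rw [← hc]
    congr 1
    exact inj (Subsingleton.elim _ _)

/-- The point `z` gives two morphisms from the spectrum of its residue field to `Y` over `X`. The
base change of `p` to that spectrum is an isomorphism, so they coincide, and `z` lies on the
diagonal `d`. -/
theorem mem_range_of_section (h : IsIsoOutside p U) {P : Scheme.{u}} {a b : P ⟶ Y}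
    (hP : IsPullback a b p p) {d : Y ⟶ P} (hda : d ≫ a = 𝟙 Y) (hdb : d ≫ b = 𝟙 Y) {z : P}
    (hz : (a ≫ p) z ∉ U) : z ∈ Set.range d := by
  let c := P.fromSpecResidueField z
  have ha : (c ≫ a) ≫ p = 𝟙 _ ≫ c ≫ a ≫ p := by simp
  have hb : (c ≫ b) ≫ p = 𝟙 _ ≫ c ≫ a ≫ p := by simp [hP.w]
  have := h (c ≫ a ≫ p) (fun x hx ↦ hz (by simpa [c] using hx))
  have heq : pullback.lift _ _ ha = pullback.lift _ _ hb := by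
    rw [← cancel_mono (pullback.snd p (c ≫ a ≫ p)), pullback.lift_snd, pullback.lift_snd]
  replace heq := congr_arg (· ≫ pullback.fst _ _) heq
  simp only [pullback.lift_fst] at heq
  have hc : (c ≫ a) ≫ d = c := by
    apply hP.hom_ext
    · rw [Category.assoc, hda, Category.comp_id]
    · rw [Category.assoc, hdb, Category.comp_id, heq]
  refine ⟨(c ≫ a) default, ?_⟩
  rw [← Scheme.Hom.comp_apply, hc]
  exact Scheme.fromSpecResidueField_apply _ _

end IsIsoOutside

/-- Sections of étale morphisms are open immersions. -/
theorem isOpenImmersion_of_section (p : Y ⟶ X) [Etale p] (s : X ⟶ Y) (h : s ≫ p = 𝟙 X) :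
    IsOpenImmersion s := by
  have : Etale (s ≫ p) := by rw [h]; infer_instance
  have : Etale s := .of_comp s p
  have : Mono s := mono_of_mono_fac h
  exact .of_flat_of_mono s

end AlgebraicGeometry

/-! ### Distinguished squares: reformulation, stability, diagonal squares and first consequences. -/

namespace EquivariantNisnevich

theorem range_complementIdeal_subschemeι {A X : Scheme.{u}} (j : A ⟶ X) [IsOpenImmersion j] :
    Set.range (complementIdeal j).subschemeι = (Set.range j)ᶜ := by
  rw [Scheme.IdealSheafData.range_subschemeι, complementIdeal,
    Scheme.IdealSheafData.coe_support_vanishingIdeal, TopologicalSpace.Closeds.coe_closure]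
  exact j.isOpenEmbedding.isOpen_range.isClosed_compl.closure_eq

instance {A X : Scheme.{u}} (j : A ⟶ X) : IsReduced (complementIdeal j).subscheme := by
  unfold complementIdeal; infer_instance

section

variable {A B X Y : Scheme.{u}} {k : B ⟶ Y} {q : B ⟶ A} {p : Y ⟶ X} {j : A ⟶ X}

/-- The inverse of `r` gives a section of the étale base change of `p` to `(X ∖ A)_red`. Such a
section is an open immersion. It is surjective because the base change has only points over `Y ∖ B`,
so it is an isomorphism inverse to the projection. -/
theorem isIso_pullback_snd_complement (h : IsPullback k q p j) [IsOpenImmersion j] [Etale p]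
    (r : (complementIdeal k).subscheme ⟶ (complementIdeal j).subscheme) [IsIso r]
    (hr : r ≫ (complementIdeal j).subschemeι = (complementIdeal k).subschemeι ≫ p) :
    IsIso (pullback.snd p (complementIdeal j).subschemeι) := by
  have : IsOpenImmersion k := MorphismProperty.of_isPullback h.flip ‹_›
  let i := (complementIdeal j).subschemeι
  let s : (complementIdeal j).subscheme ⟶ pullback p i :=
    pullback.lift (inv r ≫ (complementIdeal k).subschemeι) (𝟙 _) (by simp [← hr, i])
  have hs : s ≫ pullback.snd p i = 𝟙 _ := pullback.lift_snd _ _ _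
  have hs' : s ≫ pullback.fst p i = inv r ≫ (complementIdeal k).subschemeι :=
    pullback.lift_fst _ _ _
  have := isOpenImmersion_of_section _ s hs
  have : Surjective s := by
    refine ⟨fun w ↦ ?_⟩
    have hw : p (pullback.fst p i w) = i (pullback.snd p i w) := by
      rw [← Scheme.Hom.comp_apply, ← Scheme.Hom.comp_apply, pullback.condition]
    have hwB : pullback.fst p i w ∉ Set.range k := by
      rintro ⟨b, hb⟩
      have : i (pullback.snd p i w) ∈ (Set.range j)ᶜ :=
        range_complementIdeal_subschemeι j ▸ Set.mem_range_self _
      refine this ⟨q b, ?_⟩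
      rw [← hw, ← hb, ← Scheme.Hom.comp_apply, ← Scheme.Hom.comp_apply, h.w]
    obtain ⟨w', hw'⟩ : pullback.fst p i w ∈ Set.range (complementIdeal k).subschemeι := by
      rw [range_complementIdeal_subschemeι]; exact hwB
    refine ⟨r w', (pullback.fst p i).isClosedEmbedding.injective ?_⟩
    rw [← Scheme.Hom.comp_apply, ← Scheme.Hom.comp_apply, hs', IsIso.hom_inv_id_assoc, hw']
  have : IsIso s := (isIso_iff_isOpenImmersion_and_surjective s).2 ⟨‹_›, ‹_›⟩
  exact ⟨s, by rw [← cancel_epi s, reassoc_of% hs, Category.comp_id], hs⟩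

theorem exists_lift_complement {A X T : Scheme.{u}} (j : A ⟶ X) [IsReduced T] (t : T ⟶ X)
    (ht : ∀ a, t a ∉ Set.range j) :
    ∃ s : T ⟶ (complementIdeal j).subscheme, s ≫ (complementIdeal j).subschemeι = t := by
  refine ⟨_, IsClosedImmersion.lift_fac _ _ ?_⟩
  rw [t.ker_eq_vanishingIdeal, Scheme.IdealSheafData.ker_subschemeι]
  refine Scheme.IdealSheafData.vanishingIdeal_antimono ?_
  exact TopologicalSpace.Closeds.gc.monotone_l (by rintro _ ⟨a, rfl⟩; exact ht a)

/-- The complement `(X ∖ A)_red` is the universal test scheme: every reduced scheme avoiding `A`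
maps through it. Conversely, testing on it shows that its preimage in `Y` is reduced, hence equal to
`(Y ∖ B)_red`. -/
theorem isIsoOutside_iff (h : IsPullback k q p j) [IsOpenImmersion j] [Etale p] :
    IsIsoOutside p (Set.range j) ↔
    ∃ r : (complementIdeal k).subscheme ⟶ (complementIdeal j).subscheme,
      r ≫ (complementIdeal j).subschemeι = (complementIdeal k).subschemeι ≫ p ∧ IsIso r := by
  have : IsOpenImmersion k := MorphismProperty.of_isPullback h.flip ‹_›
  refine ⟨fun H ↦ ?_, ?_⟩
  · let i := (complementIdeal j).subschemeι
    have hi : ∀ a, i a ∉ Set.range j := fun a ↦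
      (range_complementIdeal_subschemeι j).le (Set.mem_range_self a)
    have := H i hi
    have : IsReduced (pullback p i) := isReduced_of_isOpenImmersion (pullback.snd p i)
    have hker : (complementIdeal k).subschemeι.ker = (pullback.fst p i).ker := by
      rw [(pullback.fst p i).ker_eq_vanishingIdeal, Scheme.IdealSheafData.ker_subschemeι,
        complementIdeal, Scheme.Pullback.range_fst, range_complementIdeal_subschemeι,
        Set.preimage_compl, h.range_fst_eq]
    have := IsClosedImmersion.isIso_lift _ _ hker
    refine ⟨inv (IsClosedImmersion.lift _ _ hker.le) ≫ pullback.snd p i, ?_, inferInstance⟩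
    rw [Category.assoc, ← pullback.condition, IsIso.inv_comp_eq,
      IsClosedImmersion.lift_fac_assoc]
  · rintro ⟨r, hr, _⟩ T _ t ht
    have := isIso_pullback_snd_complement h r hr
    obtain ⟨s, rfl⟩ := exists_lift_complement j t ht
    have h₁ := IsPullback.of_hasPullback (pullback.snd p (complementIdeal j).subschemeι) s
    have h₂ := h₁.flip.paste_vert (IsPullback.of_hasPullback p (complementIdeal j).subschemeι).flip
    rw [← h₂.flip.isoPullback_inv_snd]
    infer_instance

end

theorem _root_.CategoryTheory.Square.baseChange_isPullback {C : Type u} [Category.{v} C]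
    [HasPullbacks C] {Q : Square C} (h : Q.IsPullback) {X' : C} (f : X' ⟶ Q.X₄) :
    (Q.baseChange f).IsPullback := by
  have h₂ : CategoryTheory.IsPullback (pullback.fst Q.f₂₄ f) (pullback.snd Q.f₂₄ f) Q.f₂₄ f :=
    .of_hasPullback _ _
  have h₃ : CategoryTheory.IsPullback (pullback.fst Q.f₃₄ f) (pullback.snd Q.f₃₄ f) Q.f₃₄ f :=
    .of_hasPullback _ _
  have h₁ : CategoryTheory.IsPullback (pullback.fst (Q.f₁₂ ≫ Q.f₂₄) f)
      (pullback.snd (Q.f₁₂ ≫ Q.f₂₄) f) (Q.f₁₂ ≫ Q.f₂₄) f := .of_hasPullback _ _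
  let a : pullback (Q.f₁₂ ≫ Q.f₂₄) f ⟶ pullback Q.f₂₄ f :=
    pullback.lift (pullback.fst _ _ ≫ Q.f₁₂) (pullback.snd _ _)
      (by rw [Category.assoc, pullback.condition])
  let b : pullback (Q.f₁₂ ≫ Q.f₂₄) f ⟶ pullback Q.f₃₄ f :=
    pullback.lift (pullback.fst _ _ ≫ Q.f₁₃) (pullback.snd _ _)
      (by rw [Category.assoc, ← Q.fac, pullback.condition])
  have ha₁ : a ≫ pullback.fst _ _ = pullback.fst _ _ ≫ Q.f₁₂ := pullback.lift_fst _ _ _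
  have ha₂ : a ≫ pullback.snd _ _ = pullback.snd _ _ := pullback.lift_snd _ _ _
  have hb₁ : b ≫ pullback.fst _ _ = pullback.fst _ _ ≫ Q.f₁₃ := pullback.lift_fst _ _ _
  have hb₂ : b ≫ pullback.snd _ _ = pullback.snd _ _ := pullback.lift_snd _ _ _
  have h₄ : CategoryTheory.IsPullback b (pullback.fst _ _) (pullback.fst Q.f₃₄ f) Q.f₁₃ := by
    refine .of_right (h₁₂ := pullback.snd _ _) (h₂₂ := Q.f₃₄) (v₁₃ := f) ?_ hb₁ h₃.flip
    rw [hb₂, ← Q.fac]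
    exact h₁.flip
  have h₅ : CategoryTheory.IsPullback Q.f₁₂ Q.f₁₃ Q.f₂₄ Q.f₃₄ := h
  change CategoryTheory.IsPullback a b (pullback.snd _ _) (pullback.snd _ _)
  refine .of_right ?_ (by rw [ha₂, hb₂]) h₂
  rw [ha₁, ← pullback.condition]
  exact h₄.flip.paste_horiz h₅

/-- Both copies of `B` are `Y ×_X A`. For a distinguished square, `B ×_A B ⟶ Y ×_X Y` is therefore
an open immersion with image the preimage of `A`. -/
theorem _root_.CategoryTheory.Square.isPullback_relativeMap {C : Type u} [Category.{v} C]
    [HasPullbacks C] {Q : Square C} (h : Q.IsPullback) :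
    CategoryTheory.IsPullback Q.relativeMap (pullback.fst Q.f₁₃ Q.f₁₃ ≫ Q.f₁₃)
      (pullback.fst Q.f₂₄ Q.f₂₄ ≫ Q.f₂₄) Q.f₃₄ := by
  have h' : CategoryTheory.IsPullback Q.f₁₂ Q.f₁₃ Q.f₂₄ Q.f₃₄ := h
  have w (s : PullbackCone (pullback.fst Q.f₂₄ Q.f₂₄ ≫ Q.f₂₄) Q.f₃₄) :
      (s.fst ≫ pullback.snd Q.f₂₄ Q.f₂₄) ≫ Q.f₂₄ = s.snd ≫ Q.f₃₄ := by
    rw [← s.condition, Category.assoc, ← pullback.condition]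
  have w' (s : PullbackCone (pullback.fst Q.f₂₄ Q.f₂₄ ≫ Q.f₂₄) Q.f₃₄) :
      (s.fst ≫ pullback.fst Q.f₂₄ Q.f₂₄) ≫ Q.f₂₄ = s.snd ≫ Q.f₃₄ := by
    rw [← s.condition, Category.assoc]
  refine ⟨⟨?_⟩, ⟨PullbackCone.IsLimit.mk _
    (fun s ↦ pullback.lift (h'.lift _ _ (w' s)) (h'.lift _ _ (w s)) ?_) ?_ ?_ ?_⟩⟩
  · rw [← Category.assoc, Square.relativeMap_fst, Category.assoc, Category.assoc, Q.fac]
  · rw [h'.lift_snd, h'.lift_snd]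
  · intro s
    apply pullback.hom_ext
    · rw [Category.assoc, Square.relativeMap_fst, pullback.lift_fst_assoc, h'.lift_fst]
    · rw [Category.assoc, Square.relativeMap_snd, pullback.lift_snd_assoc, h'.lift_fst]
  · intro s
    rw [pullback.lift_fst_assoc, h'.lift_snd]
  · intro s m h₁ h₂
    apply pullback.hom_ext
    · rw [pullback.lift_fst]
      apply h'.hom_ext
      · rw [h'.lift_fst, Category.assoc, ← Square.relativeMap_fst, reassoc_of% h₁]
      · rw [h'.lift_snd, Category.assoc, h₂]
    · rw [pullback.lift_snd]
      apply h'.hom_ext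
      · rw [h'.lift_fst, Category.assoc, ← Square.relativeMap_snd, reassoc_of% h₁]
      · rw [h'.lift_snd, Category.assoc, ← pullback.condition, h₂]

variable {S : Scheme.{u}} {G : Over S} [GrpObj G]

theorem isDistinguished_iff (Q : Square (GSch G)) : IsDistinguished G Q ↔ Q.IsPullback ∧
    IsOpenImmersion ((GSch.forget G).map Q.f₃₄) ∧ Etale ((GSch.forget G).map Q.f₂₄) ∧
    IsIsoOutside ((GSch.forget G).map Q.f₂₄) (Set.range ((GSch.forget G).map Q.f₃₄)) := by
  refine ⟨fun ⟨h₁, h₂, h₃, h₄⟩ ↦ ⟨h₁, h₂, h₃, ?_⟩, fun ⟨h₁, h₂, h₃, h₄⟩ ↦ ⟨h₁, h₂, h₃, ?_⟩⟩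
  · exact (isIsoOutside_iff (CategoryTheory.IsPullback.map (GSch.forget G) h₁)).2 h₄
  · exact (isIsoOutside_iff (CategoryTheory.IsPullback.map (GSch.forget G) h₁)).1 h₄

theorem IsDistinguished.exists_preimage {Q : Square (GSch G)} (hQ : IsDistinguished G Q)
    (x : (GSch.forget G).obj Q.X₄) :
    (∃ y, (GSch.forget G).map Q.f₂₄ y = x) ∨ ∃ a, (GSch.forget G).map Q.f₃₄ a = x := by
  by_cases h : x ∈ Set.range ((GSch.forget G).map Q.f₃₄)
  · exact .inr h
  · exact .inl (((isDistinguished_iff Q).1 hQ).2.2.2.existsUnique h).exists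

theorem isStable_nisnevichCD : (nisnevichCD G).IsStable := by
  intro Q hQ X' f
  obtain ⟨h₁, h₂, h₃, h₄⟩ := (isDistinguished_iff Q).1 hQ
  have p₂ := (IsPullback.of_hasPullback Q.f₂₄ f).map (GSch.forget G)
  have p₃ := (IsPullback.of_hasPullback Q.f₃₄ f).map (GSch.forget G)
  refine (isDistinguished_iff _).2 ⟨Square.baseChange_isPullback h₁ f,
    MorphismProperty.of_isPullback p₃ h₂, MorphismProperty.of_isPullback p₂ h₃, ?_⟩
  have := h₄.of_isPullback p₂
  rw [← p₃.flip.range_fst_eq] at this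
  exact this

theorem IsDistinguished.mono {Q : Square (GSch G)} (hQ : IsDistinguished G Q) : Mono Q.f₃₄ := by
  have := hQ.isOpenImmersion
  exact (GSch.forget G).mono_of_mono_map inferInstance

/-- Both sides ending at `Y ×_X Y` are open immersions: the diagonal as a section of an étale
projection, `Q.relativeMap` as a base change of `A ⟶ X`. Only surjectivity away from the diagonal
remains, and `mem_range_of_section` puts every point over `X ∖ A` on the diagonal. -/
theorem IsDistinguished.diagonalSquare {Q : Square (GSch G)} (hQ : IsDistinguished G Q) :
    IsDistinguished G Q.diagonalSquare := by
  obtain ⟨h₁, h₂, h₃, h₄⟩ := (isDistinguished_iff Q).1 hQ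
  let F := GSch.forget G
  have e₁ : IsOpenImmersion (F.map (pullback.diagonal Q.f₂₄)) := by
    have hp := (IsPullback.of_hasPullback Q.f₂₄ Q.f₂₄).map F
    have : Etale (F.map (pullback.fst Q.f₂₄ Q.f₂₄)) := MorphismProperty.of_isPullback hp.flip h₃
    refine isOpenImmersion_of_section (F.map (pullback.fst Q.f₂₄ Q.f₂₄)) _ ?_
    rw [← F.map_comp, pullback.diagonal_fst, F.map_id]
  have e₂ : IsPullback (F.map Q.relativeMap) (F.map (pullback.fst Q.f₁₃ Q.f₁₃ ≫ Q.f₁₃))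
      (F.map (pullback.fst Q.f₂₄ Q.f₂₄ ≫ Q.f₂₄)) (F.map Q.f₃₄) :=
    (Square.isPullback_relativeMap h₁).map F
  have e₃ : IsOpenImmersion (F.map Q.relativeMap) := MorphismProperty.of_isPullback e₂.flip h₂
  refine (isDistinguished_iff _).2 ⟨Q.diagonalSquare_isPullback, e₁,
    inferInstanceAs (Etale (F.map Q.relativeMap)), ?_⟩
  change IsIsoOutside (F.map Q.relativeMap) (Set.range (F.map (pullback.diagonal Q.f₂₄)))
  intro T _ t ht
  rw [isIso_iff_isOpenImmersion_and_surjective]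
  refine ⟨inferInstance, ⟨fun a ↦ ?_⟩⟩
  change a ∈ Set.range (pullback.snd (F.map Q.relativeMap) t)
  rw [Scheme.Pullback.range_snd]
  change t a ∈ Set.range (F.map Q.relativeMap)
  by_contra ha
  rw [e₂.range_fst_eq] at ha
  refine ht a ?_
  refine h₄.mem_range_of_section ((IsPullback.of_hasPullback Q.f₂₄ Q.f₂₄).map F) ?_ ?_
    (by rwa [← F.map_comp])
  · rw [← F.map_comp, pullback.diagonal_fst, F.map_id]
  · rw [← F.map_comp, pullback.diagonal_snd, F.map_id]

instance : IsEmpty ((GSch.forget G).obj (⊥_ (GSch G))) := by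
  have : IsEmpty ((GSch.forget G).obj (GSch.empty G)) := isEmpty_emptyOver S
  exact Function.isEmpty ((GSch.forget G).map (initial.to (GSch.empty G)))

theorem GSch.isIso_of_isEmpty {X Y : GSch G} (f : X ⟶ Y) (h : IsEmpty ((GSch.forget G).obj Y)) :
    IsIso f := by
  have : IsIso ((GSch.forget G).map f) := inferInstance
  exact isIso_of_reflects_iso f (GSch.forget G)

theorem GSch.nonempty_iso_initial_iff (X : GSch G) :
    Nonempty (X ≅ ⊥_ (GSch G)) ↔ IsEmpty ((GSch.forget G).obj X) := by
  refine ⟨fun ⟨e⟩ ↦ Function.isEmpty ((GSch.forget G).map e.hom), fun h ↦ ?_⟩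
  have := GSch.isIso_of_isEmpty (initial.to X) h
  exact ⟨(asIso (initial.to X)).symm⟩

instance : HasStrictInitialObjects (GSch G) :=
  hasStrictInitialObjects_of_initial_is_strict fun _ f ↦ GSch.isIso_of_isEmpty f inferInstance

theorem isComplete_nisnevichCD : (nisnevichCD G).IsComplete := by
  refine CDStructure.isComplete_of_isStable isStable_nisnevichCD fun Q hQ h₂ h₃ ↦ ?_
  rw [GSch.nonempty_iso_initial_iff] at h₂ h₃ ⊢
  exact ⟨fun x ↦ (hQ.exists_preimage x).elim (fun ⟨y, _⟩ ↦ h₂.elim y) (fun ⟨y, _⟩ ↦ h₃.elim y)⟩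

theorem IsDistinguished.ofTwoArrows_mem {Q : Square (GSch G)} (hQ : IsDistinguished G Q) :
    Sieve.ofTwoArrows Q.f₂₄ Q.f₃₄ ∈ nisnevichTopology G Q.X₄ :=
  (nisnevichCD G).ofTwoArrows_mem_topology hQ

theorem isRegular_nisnevichCD [CompactSpace S] [S.IsSeparated] : (nisnevichCD G).IsRegular :=
  fun Q hQ ↦ ⟨hQ.isPullback, hQ.mono,
    isLocallySurjective_diagonalMap Q hQ.diagonalSquare.ofTwoArrows_mem⟩

theorem isSheaf_nisnevichTopology_iff (F : (GSch G)ᵒᵖ ⥤ Type w) :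
    Presieve.IsSheaf (nisnevichTopology G) F ↔
      Nonempty (Unique (F.obj (op (GSch.empty G)))) ∧
        ∀ Q : Square (GSch G), IsDistinguished G Q → (Q.op.map F).IsPullback := by
  let e : F.obj (op (GSch.empty G)) ≃ F.obj (op (⊥_ (GSch G))) :=
    (F.mapIso ((initialIsInitial.uniqueUpToIso (GSch.emptyIsInitial G)).op)).toEquiv
  refine ⟨fun h ↦ ⟨(CDStructure.unique_of_isSheaf h).map (@Equiv.unique _ _ · e), fun Q hQ ↦ ?_⟩,
    fun ⟨h₀, h⟩ ↦ ?_⟩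
  · have := hQ.mono
    exact CDStructure.isPullback_of_isSheaf h hQ hQ.isPullback hQ.diagonalSquare
  · exact CDStructure.isSheaf_of_isPullback isStable_nisnevichCD F
      (h₀.map (@Equiv.unique _ _ · e.symm)) h

end EquivariantNisnevich

/-! ### Codimension of points under étale morphisms and open immersions; finite dimension. -/

open TopologicalSpace in
-- There are finitely many irreducible components of `K`, so `x` is in the closure of `Z ∩ U` for
-- one of them; the generic point of this `Z` lies in `U` and specializes to `x`.
theorem exists_specializes_of_mem_closure {X : Type*} [TopologicalSpace X] [NoetherianSpace X]
    [QuasiSober X] {K U : Set X} (hK : IsClosed K) (hU : IsOpen U) {x : X}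
    (hx : x ∈ closure (K ∩ U)) : ∃ y ∈ K ∩ U, y ⤳ x := by
  obtain ⟨T, hT, hT', hT'', rfl⟩ := NoetherianSpace.exists_finite_set_isClosed_irreducible hK
  obtain ⟨Z, hZ, hx⟩ : ∃ Z ∈ T, x ∈ closure (Z ∩ U) := by
    rw [Set.sUnion_eq_biUnion, Set.iUnion₂_inter, hT.closure_biUnion] at hx
    simpa using hx
  have hgen := (hT'' Z hZ).isGenericPoint_genericPoint (hT' Z hZ)
  have hne : (Z ∩ U).Nonempty := by
    rw [← closure_nonempty_iff]; exact ⟨x, hx⟩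
  refine ⟨(hT'' Z hZ).genericPoint, ⟨⟨Z, hZ, hgen.mem⟩, ?_⟩, ?_⟩
  · exact (hgen.mem_open_set_iff hU).2 hne
  · refine hgen.specializes ?_
    exact closure_minimal Set.inter_subset_left (hT' Z hZ) hx

namespace AlgebraicGeometry

theorem locallyQuasiFinite_of_etale {X Y : Scheme.{u}} (p : Y ⟶ X) [Etale p] :
    LocallyQuasiFinite p := by
  refine ⟨fun {U} hU {V} hV e ↦ ?_⟩
  have h := HasRingHomProperty.appLE @Etale p ‹_› ⟨U, hU⟩ ⟨V, hV⟩ e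
  algebraize [(p.appLE U V e).hom]
  exact (inferInstance : Algebra.QuasiFinite Γ(X, U) Γ(Y, V))

/-- Étale morphisms are quasi-finite, so their fibres are discrete. -/
theorem eq_of_specializes_of_etale {X Y : Scheme.{u}} (p : Y ⟶ X) [Etale p] {y y' : Y}
    (h : y ⤳ y') (hp : p y = p y') : y = y' := by
  have := locallyQuasiFinite_of_etale p
  exact (p.isDiscrete_preimage_singleton (p y)).eq_of_specializes h rfl hp.symm

theorem strictMono_of_etale {X Y : Scheme.{u}} (p : Y ⟶ X) [Etale p] : StrictMono p := by
  refine fun a b hab ↦ ⟨hab.le.map p.continuous, fun h ↦ ?_⟩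
  have h₁ : b ⤳ a := hab.le
  have h₂ : p a ⤳ p b := h
  obtain rfl := eq_of_specializes_of_etale p h₁ ((h₁.map p.continuous).antisymm h₂).eq
  exact hab.ne rfl

/-- In the order on points `x ≤ y` means `y ⤳ x`, so `Order.coheight` is the codimension of the
closure of a point. Étale morphisms carry strict chains of generizations to strict chains. -/
theorem coheight_le_coheight_of_etale {X Y : Scheme.{u}} (p : Y ⟶ X) [Etale p] (y : Y) :
    Order.coheight y ≤ Order.coheight (p y) :=
  Order.coheight_le_coheight_apply_of_strictMono _ (strictMono_of_etale p) y

theorem coheight_isOpenImmersion {X Y : Scheme.{u}} (p : Y ⟶ X) [IsOpenImmersion p] (y : Y) :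
    Order.coheight (p y) = Order.coheight y := by
  exact p.isOpenEmbedding.coheight_eq

theorem krullDim_eq_topologicalKrullDim (X : Scheme.{u}) :
    Order.krullDim X = topologicalKrullDim X := by
  let := specializationOrder X
  exact Order.krullDim_eq_of_orderIso (irreducibleSetEquivPoints (α := X)).symm

/-- The ring of `V` is a quotient of a polynomial ring in `m` variables over the Noetherian ring of
`U`, so its dimension exceeds that of the latter by at most `m`. -/
theorem exists_coheight_le_of_affine {S X : Scheme.{u}} [IsLocallyNoetherian S]
    (hS : topologicalKrullDim S < ⊤) (f : X ⟶ S) [LocallyOfFiniteType f] {U : S.Opens}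
    (hU : IsAffineOpen U) {V : X.Opens} (hV : IsAffineOpen V) (e : V ≤ f ⁻¹ᵁ U) :
    ∃ n : ℕ, ∀ x ∈ V, Order.coheight x ≤ n := by
  have h := f.finiteType_appLE hU hV e
  algebraize [(f.appLE U V e).hom]
  obtain ⟨m, φ, hφ⟩ := Algebra.FiniteType.iff_quotient_mvPolynomial''.1
    (inferInstance : Algebra.FiniteType Γ(S, U) Γ(X, V))
  have : IsNoetherianRing Γ(S, U) := IsLocallyNoetherian.component_noetherian ⟨U, hU⟩
  have hR : ringKrullDim Γ(S, U) < ⊤ := by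
    refine lt_of_le_of_lt ?_ hS
    rw [← PrimeSpectrum.topologicalKrullDim_eq_ringKrullDim]
    exact hU.fromSpec.isOpenEmbedding.isInducing.topologicalKrullDim_le
  have h₁ : ringKrullDim Γ(X, V) ≤ ringKrullDim Γ(S, U) + m := by
    refine (ringKrullDim_le_of_surjective φ.toRingHom hφ).trans ?_
    rw [MvPolynomial.ringKrullDim_of_isNoetherianRing]
    simp
  obtain ⟨n, hn⟩ : ∃ n : ℕ, ringKrullDim Γ(S, U) ≤ n := by
    generalize ringKrullDim Γ(S, U) = d at hR
    induction d using WithBot.recBotCoe with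
    | bot => exact ⟨0, bot_le⟩
    | coe d =>
      lift d to ℕ using (WithBot.coe_lt_coe.1 hR).ne
      exact ⟨d, le_rfl⟩
  refine ⟨n + m, fun x hx ↦ ?_⟩
  obtain ⟨y, rfl⟩ : x ∈ Set.range hV.fromSpec := by rwa [hV.range_fromSpec]
  rw [coheight_isOpenImmersion]
  have := Order.coheight_le_krullDim y
  rw [krullDim_eq_topologicalKrullDim] at this
  replace this := this.trans_eq (PrimeSpectrum.topologicalKrullDim_eq_ringKrullDim _)
  exact_mod_cast this.trans (h₁.trans (add_le_add_left hn _))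

theorem exists_coheight_le {S X : Scheme.{u}} [IsLocallyNoetherian S]
    (hS : topologicalKrullDim S < ⊤) (f : X ⟶ S) [LocallyOfFiniteType f] [CompactSpace X] :
    ∃ n : ℕ, ∀ x : X, Order.coheight x ≤ n := by
  have h (x : X) : ∃ (V : X.Opens), x ∈ V ∧ ∃ n : ℕ, ∀ x ∈ V, Order.coheight x ≤ n := by
    obtain ⟨_, ⟨U, hU, rfl⟩, hxU, -⟩ := S.isBasis_affineOpens.exists_subset_of_mem_open
      (Set.mem_univ (f x)) isOpen_univ
    obtain ⟨_, ⟨V, hV, rfl⟩, hxV, hVU⟩ := X.isBasis_affineOpens.exists_subset_of_mem_open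
      (a := x) (u := f ⁻¹ᵁ U) hxU (f ⁻¹ᵁ U).isOpen
    exact ⟨V, hxV, exists_coheight_le_of_affine hS f hU hV hVU⟩
  choose V hxV n hn using h
  obtain ⟨t, ht⟩ := CompactSpace.elim_nhds_subcover (fun x ↦ (V x : Set X))
    fun x ↦ (V x).isOpen.mem_nhds (hxV x)
  refine ⟨t.sup n, fun x ↦ ?_⟩
  obtain ⟨y, hy, hx⟩ : ∃ y ∈ t, x ∈ V y := by simpa using ht.ge (Set.mem_univ x)
  exact (hn y x hx).trans (by exact_mod_cast Finset.le_sup hy)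

end AlgebraicGeometry

/-! ### Invariant subsets of `G`-schemes and invariant open subschemes. -/

section Invariant

open MonoidalCategory CartesianMonoidalCategory MonObj

theorem CategoryTheory.CartesianMonoidalCategory.isPullback_whiskerLeft_snd {C : Type u}
    [Category.{v} C] [CartesianMonoidalCategory C] (M : C) {X Y : C} (f : X ⟶ Y) :
    IsPullback (M ◁ f) (snd M X) (snd M Y) f := by
  refine ⟨⟨by simp⟩, ⟨PullbackCone.IsLimit.mk _ (fun s ↦ lift (s.fst ≫ fst M Y) s.snd)
    (fun s ↦ ?_) (fun s ↦ ?_) (fun s m h₁ h₂ ↦ ?_)⟩⟩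
  · ext
    · simp
    · simp [s.condition]
  · simp
  · ext
    · simp [← h₁]
    · simp [h₂]

namespace EquivariantNisnevich

variable {S : Scheme.{u}} {G : Over S} [GrpObj G]

/-- The action morphism `G ×_S X ⟶ X` of a `G`-scheme `X`. -/
noncomputable def GSch.act (X : GSch G) : (G ⊗ X.obj.X).left ⟶ (GSch.forget G).obj X :=
  (fst G X.obj.X • snd G X.obj.X).left

/-- The projection `G ×_S X ⟶ X`. -/
noncomputable def GSch.proj (X : GSch G) : (G ⊗ X.obj.X).left ⟶ (GSch.forget G).obj X :=
  (snd G X.obj.X).left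

/-- The morphism `G ×_S X ⟶ G ×_S Y` induced by a morphism `X ⟶ Y`. -/
noncomputable def GSch.prodMap {X Y : GSch G} (f : X ⟶ Y) :
    (G ⊗ X.obj.X).left ⟶ (G ⊗ Y.obj.X).left :=
  (G ◁ GSch.over f).left

theorem GSch.isPullback_prodMap {X Y : GSch G} (f : X ⟶ Y) :
    IsPullback (GSch.prodMap f) X.proj Y.proj ((GSch.forget G).map f) :=
  (isPullback_whiskerLeft_snd G (GSch.over f)).map (Over.forget S)

theorem GSch.prodMap_act {X Y : GSch G} (f : X ⟶ Y) :
    GSch.prodMap f ≫ Y.act = X.act ≫ (GSch.forget G).map f := by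
  refine congr_arg CommaMorphism.left (?_ : (G ◁ GSch.over f) ≫ (fst G Y.obj.X • snd G Y.obj.X) =
    (fst G X.obj.X • snd G X.obj.X) ≫ GSch.over f)
  rw [IsModHom.map_smul, ModObj.comp_smul]
  simp

/-- The automorphism `(g, x) ↦ (g⁻¹, g x)` of `G ×_S X`. -/
noncomputable def GSch.shear (X : GSch G) : (G ⊗ X.obj.X).left ⟶ (G ⊗ X.obj.X).left :=
  (lift (fst G X.obj.X)⁻¹ (fst G X.obj.X • snd G X.obj.X)).left

theorem GSch.shear_proj (X : GSch G) : X.shear ≫ X.proj = X.act :=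
  congr_arg CommaMorphism.left (lift_snd (fst G X.obj.X)⁻¹ (fst G X.obj.X • snd G X.obj.X))

theorem GSch.shear_act (X : GSch G) : X.shear ≫ X.act = X.proj := by
  refine congr_arg CommaMorphism.left (?_ : lift (fst G X.obj.X)⁻¹ (fst G X.obj.X • snd G X.obj.X) ≫
    (fst G X.obj.X • snd G X.obj.X) = snd G X.obj.X)
  rw [ModObj.comp_smul, lift_fst, lift_snd, inv_smul_smul]

theorem GSch.shear_shear (X : GSch G) : X.shear ≫ X.shear = 𝟙 _ := by
  refine congr_arg CommaMorphism.left
    (?_ : lift (fst G X.obj.X)⁻¹ (fst G X.obj.X • snd G X.obj.X) ≫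
    lift (fst G X.obj.X)⁻¹ (fst G X.obj.X • snd G X.obj.X) = 𝟙 _)
  ext1
  · rw [Category.assoc, lift_fst, GrpObj.comp_inv, lift_fst, inv_inv, Category.id_comp]
  · rw [Category.assoc, lift_snd, ModObj.comp_smul, lift_fst, lift_snd, inv_smul_smul,
      Category.id_comp]

/-- A subset of a `G`-scheme is invariant if its preimages under the action morphism and the
projection `G ×_S X ⟶ X` agree. -/
def GSch.IsInvariant (X : GSch G) (T : Set ((GSch.forget G).obj X)) : Prop :=
  X.act ⁻¹' T = X.proj ⁻¹' T

namespace GSch.IsInvariant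

variable {X Y : GSch G}

/-- The shear automorphism exchanges action and projection, hence also the two inclusions. -/
theorem of_subset {T : Set ((GSch.forget G).obj X)} (h : X.proj ⁻¹' T ⊆ X.act ⁻¹' T) :
    X.IsInvariant T := by
  refine subset_antisymm ?_ h
  have := Set.preimage_mono (f := X.shear) h
  rwa [← Set.preimage_comp, ← Set.preimage_comp, ← TopCat.coe_comp, ← TopCat.coe_comp,
    ← Scheme.Hom.comp_base, ← Scheme.Hom.comp_base, GSch.shear_proj, GSch.shear_act] at this

theorem compl {T : Set ((GSch.forget G).obj X)} (h : X.IsInvariant T) : X.IsInvariant Tᶜ :=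
  congr_arg Compl.compl (show X.act ⁻¹' T = X.proj ⁻¹' T from h)

theorem union {T T' : Set ((GSch.forget G).obj X)} (h : X.IsInvariant T) (h' : X.IsInvariant T') :
    X.IsInvariant (T ∪ T') :=
  congr_arg₂ (· ∪ ·) (show X.act ⁻¹' T = X.proj ⁻¹' T from h) h'

theorem inter {T T' : Set ((GSch.forget G).obj X)} (h : X.IsInvariant T) (h' : X.IsInvariant T') :
    X.IsInvariant (T ∩ T') :=
  congr_arg₂ (· ∩ ·) (show X.act ⁻¹' T = X.proj ⁻¹' T from h) h'

theorem preimage {T : Set ((GSch.forget G).obj Y)} (h : Y.IsInvariant T) (f : X ⟶ Y) :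
    X.IsInvariant ((GSch.forget G).map f ⁻¹' T) := by
  have := congr_arg (GSch.prodMap f ⁻¹' ·) h
  dsimp only at this
  rwa [← Set.preimage_comp, ← Set.preimage_comp, ← TopCat.coe_comp, ← TopCat.coe_comp,
    ← Scheme.Hom.comp_base, ← Scheme.Hom.comp_base, GSch.prodMap_act,
    (GSch.isPullback_prodMap f).w] at this

/-- By base change, a point of `G ×_S Y` over the image of `T` comes from a point of `G ×_S X` over
`T`, where invariance of `T` and equivariance of `f` apply. -/
theorem image {T : Set ((GSch.forget G).obj X)} (h : X.IsInvariant T) (f : X ⟶ Y) :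
    Y.IsInvariant ((GSch.forget G).map f '' T) := by
  apply of_subset
  have h₁ := Scheme.image_preimage_eq_of_isPullback (GSch.isPullback_prodMap f).flip T
  intro z hz
  obtain ⟨w, hw, rfl⟩ := h₁.ge hz
  refine ⟨X.act w, h.ge hw, ?_⟩
  rw [← Scheme.Hom.comp_apply, ← GSch.prodMap_act, Scheme.Hom.comp_apply]

theorem univ : X.IsInvariant Set.univ := rfl

theorem range (f : X ⟶ Y) : Y.IsInvariant (Set.range ((GSch.forget G).map f)) := by
  rw [← Set.image_univ]
  exact univ.image f

end GSch.IsInvariant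

section Flat

variable [IsLocallyNoetherian S] [LocallyOfFiniteType G.hom] [Flat G.hom]

theorem GSch.isOpenMap_proj (X : GSch G) : IsOpenMap X.proj := by
  have : LocallyOfFinitePresentation G.hom :=
    LocallyOfFinitePresentation.iff_locallyOfFiniteType.2 ‹_›
  have : UniversallyOpen X.proj := inferInstanceAs (UniversallyOpen (pullback.snd G.hom X.obj.X.hom))
  exact X.proj.isOpenMap

theorem GSch.isOpenMap_act (X : GSch G) : IsOpenMap X.act := by
  have h : IsOpenMap X.shear := by
    have : IsIso X.shear := ⟨X.shear, X.shear_shear, X.shear_shear⟩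
    exact X.shear.isOpenEmbedding.isOpenMap
  rw [← X.shear_proj, Scheme.Hom.comp_base, TopCat.coe_comp]
  exact X.isOpenMap_proj.comp h

/-- Preimages under open maps commute with closure. This is where flatness of `G` enters: the
projection is flat of finite presentation, hence open, and the action is its composite with the
shear automorphism. -/
theorem GSch.IsInvariant.closure {X : GSch G} {T : Set ((GSch.forget G).obj X)}
    (h : X.IsInvariant T) : X.IsInvariant (closure T) := by
  unfold GSch.IsInvariant
  rw [X.isOpenMap_act.preimage_closure_eq_closure_preimage X.act.continuous,
    X.isOpenMap_proj.preimage_closure_eq_closure_preimage X.proj.continuous, h]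

end Flat

theorem GSch.exists_lift {U X Z : GSch G} (i : U ⟶ X) [IsOpenImmersion ((GSch.forget G).map i)]
    (g : Z ⟶ X) (h : Set.range ((GSch.forget G).map g) ⊆ Set.range ((GSch.forget G).map i)) :
    ∃ t : Z ⟶ U, t ≫ i = g := by
  let t₀ := IsOpenImmersion.lift ((GSch.forget G).map i) ((GSch.forget G).map g) h
  have ht₀ : t₀ ≫ (GSch.forget G).map i = (GSch.forget G).map g := IsOpenImmersion.lift_fac _ _ _
  let t : Z.obj.X ⟶ U.obj.X := Over.homMk t₀ (by
    change t₀ ≫ U.toBase = Z.toBase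
    rw [← GSch.map_toBase i, reassoc_of% ht₀, GSch.map_toBase])
  have ht : t ≫ GSch.over i = GSch.over g := by ext1; exact ht₀
  have : Mono (GSch.over i) :=
    (Over.forget S).mono_of_mono_map (inferInstanceAs (Mono ((GSch.forget G).map i)))
  have : IsModHom G t := .of_fst_smul_snd _ (by
    rw [← cancel_mono (GSch.over i), Category.assoc, ht, IsModHom.map_smul, IsModHom.map_smul,
      Category.assoc, ht])
  exact ⟨GSch.homMk t, by ext1; ext1; exact ht⟩

/-- Invariance makes the action on `T` land in `T`; the axioms are inherited because the inclusion
is a monomorphism. -/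
theorem GSch.IsInvariant.exists_isOpenImmersion [IsLocallyNoetherian S] {X : GSch G}
    {T : Set ((GSch.forget G).obj X)} (h : X.IsInvariant T) (hT : IsOpen T) :
    ∃ (U : GSch G) (i : U ⟶ X), IsOpenImmersion ((GSch.forget G).map i) ∧
      Set.range ((GSch.forget G).map i) = T := by
  let V : ((GSch.forget G).obj X).Opens := ⟨T, hT⟩
  let U : Over S := Over.mk (V.ι ≫ X.toBase)
  let i : U ⟶ X.obj.X := Over.homMk V.ι
  have : Mono i := (Over.forget S).mono_of_mono_map (inferInstanceAs (Mono V.ι))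
  have key {Z : Over S} (g : Z ⟶ X.obj.X) (hg : Set.range g.left ⊆ T) : ∃ t : Z ⟶ U, t ≫ i = g := by
    have hg' : Set.range g.left ⊆ Set.range V.ι := 
      hg.trans_eq (Scheme.Opens.range_ι V).symm
    have ht₀ : IsOpenImmersion.lift V.ι g.left hg' ≫ V.ι = g.left := IsOpenImmersion.lift_fac _ _ _
    refine ⟨Over.homMk (IsOpenImmersion.lift V.ι g.left hg') ?_, ?_⟩
    · change _ ≫ V.ι ≫ X.toBase = _
      rw [reassoc_of% ht₀]
      exact Over.w g
    · ext1; exact ht₀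
  obtain ⟨s, hs⟩ := key (fst G U • (snd G U ≫ i)) (by
    have h₁ : fst G U • (snd G U ≫ i) = (G ◁ i) ≫ (fst G X.obj.X • snd G X.obj.X) := by
      rw [ModObj.comp_smul]; simp
    rintro _ ⟨z, rfl⟩
    rw [h₁]
    change (G ◁ i).left z ∈ X.act ⁻¹' T
    rw [show X.act ⁻¹' T = _ from h]
    have h₂ : (G ◁ i).left ≫ X.proj = (snd G U).left ≫ V.ι :=
      congr_arg CommaMorphism.left (whiskerLeft_snd G i)
    change X.proj ((G ◁ i).left z) ∈ T
    rw [← Scheme.Hom.comp_apply, h₂, Scheme.Hom.comp_apply]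
    exact ((snd G U).left z).2)
  let m : ModObj G U := .ofPoints s
    (fun Z x ↦ by rw [← cancel_mono i, Category.assoc, hs, ModObj.comp_smul]; simp)
    (fun Z g g' x ↦ by
      rw [← cancel_mono i]
      simp [hs, ModObj.comp_smul, SemigroupAction.mul_smul])
  have : IsModHom G i := .of_fst_smul_snd _ (by
    rw [← ModObj.smul_eq_fst_smul_snd]; exact hs)
  -- Needed for the open immersion `V.ι` to be quasi-compact.
  have : IsLocallyNoetherian ((GSch.forget G).obj X) := LocallyOfFiniteType.isLocallyNoetherian X.toBase
  let W : GSch G :=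
    { obj := ⟨U⟩
      property := ⟨inferInstanceAs (IsSeparated (V.ι ≫ X.toBase)),
        inferInstanceAs (LocallyOfFiniteType (V.ι ≫ X.toBase)),
        inferInstanceAs (QuasiCompact (V.ι ≫ X.toBase))⟩ }
  refine ⟨W, GSch.homMk (X := W) i, inferInstanceAs (IsOpenImmersion V.ι), ?_⟩
  exact (Scheme.Opens.range_ι V)

end EquivariantNisnevich

end Invariant

/-! ### The codimension density structure and boundedness. -/

namespace EquivariantNisnevich

variable {S : Scheme.{u}} {G : Over S} [GrpObj G]

/-- The density structure of open immersions whose complement has codimension at least `i`. -/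
noncomputable def codimDensity (G : Over S) [GrpObj G] : DensityStructure (GSch G) where
  D i _ _ f := IsOpenImmersion ((GSch.forget G).map f) ∧
    ∀ x ∉ Set.range ((GSch.forget G).map f), (i : ℕ∞) ≤ Order.coheight x
  initial_mem X := ⟨inferInstance, by simp⟩
  of_isIso i U X f hf := by
    refine ⟨inferInstance, fun x hx ↦ (hx ?_).elim⟩
    exact (Scheme.homeoOfIso (asIso ((GSch.forget G).map f))).surjective x
  anti i U X f hf := ⟨hf.1, fun x hx ↦ (by simp : (i : ℕ∞) ≤ (i + 1 : ℕ)).trans (hf.2 x hx)⟩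
  comp i V U X f g hf hg := by
    obtain ⟨_, hf⟩ := hf
    obtain ⟨_, hg⟩ := hg
    rw [Functor.map_comp]
    refine ⟨inferInstance, fun x hx ↦ ?_⟩
    by_cases hx' : x ∈ Set.range ((GSch.forget G).map g)
    · obtain ⟨u, rfl⟩ := hx'
      rw [coheight_isOpenImmersion]
      refine hf u ?_
      rintro ⟨v, rfl⟩
      exact hx ⟨v, by simp⟩
    · exact hg x hx'

theorem isIso_of_codimDensity {i : ℕ} {U X : GSch G} {f : U ⟶ X} (hf : (codimDensity G).D i f)
    (h : ∀ x : (GSch.forget G).obj X, Order.coheight x < i) : IsIso f := by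
  obtain ⟨_, hf⟩ := hf
  have : Surjective ((GSch.forget G).map f) :=
    ⟨fun x ↦ by by_contra hx; exact ((hf x hx).trans_lt (h x)).false⟩
  have : IsIso ((GSch.forget G).map f) :=
    (isIso_iff_isOpenImmersion_and_surjective _).2 ⟨inferInstance, inferInstance⟩
  exact isIso_of_reflects_iso f (GSch.forget G)

instance [CompactSpace S] (X : GSch G) : CompactSpace ((GSch.forget G).obj X) :=
  QuasiCompact.compactSpace_of_compactSpace X.toBase

theorem isLocallyFiniteDimensional_codimDensity [IsNoetherian S]
    (hS : topologicalKrullDim S < ⊤) : (codimDensity G).IsLocallyFiniteDimensional := by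
  intro X
  obtain ⟨n, hn⟩ := exists_coheight_le hS X.toBase
  refine ⟨n, fun U f hf ↦ isIso_of_codimDensity hf fun x ↦ (hn x).trans_lt ?_⟩
  exact_mod_cast n.lt_succ_self

/-- The image of a closed subset outside of the open part of a distinguished square is closed. -/
theorem IsDistinguished.isClosed_image {Q : Square (GSch G)} (hQ : IsDistinguished G Q)
    {K : Set ((GSch.forget G).obj Q.X₂)} (hK : IsClosed K) :
    IsClosed ((GSch.forget G).map Q.f₂₄ '' (K \ Set.range ((GSch.forget G).map Q.f₁₂))) := by
  obtain ⟨h₁, h₂, h₃, h₄⟩ := (isDistinguished_iff Q).1 hQ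
  let F := GSch.forget G
  have hF : IsPullback (F.map Q.f₁₂) (F.map Q.f₁₃) (F.map Q.f₂₄) (F.map Q.f₃₄) := h₁.map F
  let i := (complementIdeal (F.map Q.f₃₄)).subschemeι
  have hi : Set.range i = (Set.range (F.map Q.f₃₄))ᶜ := range_complementIdeal_subschemeι _
  have := h₄ i (fun a ↦ hi.le (Set.mem_range_self a))
  -- Over the closed subscheme `(X ∖ A)_red` the morphism `p` is an isomorphism, and the set in
  -- question is the image of `K` transported through it.
  have hc : IsClosed (i '' (pullback.snd (F.map Q.f₂₄) i '' (pullback.fst (F.map Q.f₂₄) i ⁻¹' K))) :=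
    i.isClosedEmbedding.isClosedMap _ ((Scheme.homeoOfIso (asIso
      (pullback.snd (F.map Q.f₂₄) i))).isClosedMap _ (hK.preimage (Scheme.Hom.continuous _)))
  convert hc using 1
  rw [hF.range_fst_eq]
  ext x
  constructor
  · rintro ⟨y, ⟨hy, hy'⟩, rfl⟩
    obtain ⟨z, hz⟩ := hi.ge hy'
    obtain ⟨w, hw, hw'⟩ := Scheme.Pullback.exists_preimage_pullback y z hz.symm
    exact ⟨z, ⟨w, by simpa [hw] using hy, hw'⟩, hz⟩
  · rintro ⟨_, ⟨w, hw, rfl⟩, rfl⟩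
    have e : F.map Q.f₂₄ (pullback.fst (F.map Q.f₂₄) i w) = i (pullback.snd (F.map Q.f₂₄) i w) := by
      rw [← Scheme.Hom.comp_apply, pullback.condition, Scheme.Hom.comp_apply]
    refine ⟨_, ⟨hw, fun h ↦ ?_⟩, e⟩
    rw [Set.mem_preimage, e] at h
    exact hi.le (Set.mem_range_self _) h

/-- A point of the closure is a specialization of a point of `C`. Outside the image of `j` the
specialization is proper, so the codimension grows by one; this gain is why density `i` suffices at
the corner `B` of a reducing square. -/
theorem coheight_le_of_mem_closure_image {A X : Scheme.{u}} [IsNoetherian X] (j : A ⟶ X)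
    [IsOpenImmersion j] {C : Set A} (hC : IsClosed C) {n : ℕ∞}
    (hn : ∀ a ∈ C, n ≤ Order.coheight a) {x : X} (hx : x ∈ closure (j '' C)) :
    n ≤ Order.coheight x ∧ (x ∉ Set.range j → n + 1 ≤ Order.coheight x) := by
  obtain ⟨K, hK, rfl⟩ := j.isOpenEmbedding.isInducing.isClosed_iff.1 hC
  rw [Set.image_preimage_eq_inter_range] at hx
  obtain ⟨_, ⟨hy, a, rfl⟩, hyx⟩ :=
    exists_specializes_of_mem_closure hK j.isOpenEmbedding.isOpen_range hx
  have h := hn a hy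
  rw [← coheight_isOpenImmersion j] at h
  have hle : x ≤ j a := hyx
  refine ⟨h.trans (Order.coheight_anti hle), fun hx' ↦ ?_⟩
  have hlt : x < j a := ⟨hle, fun h ↦ hx' ⟨a, (hyx.antisymm h).eq⟩⟩
  exact (add_le_add_left h 1).trans (Order.coheight_add_one_le hlt)

/-- For a test scheme `T`, the unique lift of `T` to `Y` lands in `Y'` by `hY`, which gives a
section of the base change of `p'`. That base change is a monomorphism, since its points inject into
those of the base change of `p`. Being étale, it is then a surjective open immersion. -/
theorem isIsoOutside_of_isOpenImmersion {X X' Y Y' : Scheme.{u}} {p : Y ⟶ X} {p' : Y' ⟶ X'}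
    {i : X' ⟶ X} {k : Y' ⟶ Y} [IsOpenImmersion i] [IsOpenImmersion k] [Etale p']
    (w : p' ≫ i = k ≫ p) {U : Set X} {U' : Set X'} (hU' : U' = i ⁻¹' U) (h : IsIsoOutside p U)
    (hY : ∀ y, p y ∉ U → p y ∈ Set.range i → y ∈ Set.range k) : IsIsoOutside p' U' := by
  intro T _ t ht
  subst hU'
  have := h (t ≫ i) (fun a ↦ by simpa using ht a)
  let s : T ⟶ Y := inv (pullback.snd p (t ≫ i)) ≫ pullback.fst p (t ≫ i)
  have hs : s ≫ p = t ≫ i := by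
    rw [Category.assoc, pullback.condition, IsIso.inv_hom_id_assoc]
  have hs' (a : T) : p (s a) = i (t a) := by
    rw [← Scheme.Hom.comp_apply, hs, Scheme.Hom.comp_apply]
  have hsk : Set.range s ⊆ Set.range k := by
    rintro _ ⟨a, rfl⟩
    exact hY _ (by rw [hs']; exact ht a) ⟨t a, (hs' a).symm⟩
  let s' : T ⟶ Y' := IsOpenImmersion.lift k s hsk
  have hk : s' ≫ k = s := IsOpenImmersion.lift_fac _ _ _
  have hs'' : s' ≫ p' = 𝟙 T ≫ t := by
    rw [← cancel_mono i, Category.assoc, w, reassoc_of% hk, hs, Category.id_comp]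
  have : Mono (pullback.snd p' t) := by
    refine ⟨fun {Z} a b hab ↦ pullback.hom_ext ?_ hab⟩
    have ha (a : Z ⟶ pullback p' t) : (a ≫ pullback.fst _ _ ≫ k) ≫ p =
        (a ≫ pullback.snd _ _) ≫ t ≫ i := by
      rw [Category.assoc, Category.assoc, Category.assoc, ← w, pullback.condition_assoc]
    have : pullback.lift _ _ (ha a) = pullback.lift _ _ (ha b) := by
      rw [← cancel_mono (pullback.snd p (t ≫ i)), pullback.lift_snd, pullback.lift_snd, hab]
    replace this := congr_arg (· ≫ pullback.fst _ _) this
    simpa only [pullback.lift_fst, ← Category.assoc, cancel_mono] using this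
  have : IsOpenImmersion (pullback.snd p' t) := .of_flat_of_mono _
  have : Surjective (pullback.snd p' t) :=
    ⟨fun a ↦ ⟨pullback.lift s' (𝟙 T) hs'' a, by
      rw [← Scheme.Hom.comp_apply, pullback.lift_snd]; rfl⟩⟩
  exact (isIso_iff_isOpenImmersion_and_surjective _).2 ⟨inferInstance, inferInstance⟩

/-- With `W` as below, take `X' = X ∖ W`, `A' = A ×_X X'`, and for `Y'` the part of `Y₀` over `X'`
outside the closure of `B ∖ B₀`. The refinements at `Y`, `A` and `B` then hold by construction. -/
theorem isReducing_codimDensity [IsNoetherian S] [LocallyOfFiniteType G.hom] [Flat G.hom]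
    {Q : Square (GSch G)} (hQ : IsDistinguished G Q) :
    (codimDensity G).IsReducing (nisnevichCD G) Q := by
  intro i B₀ Y₀ A₀ b y a hb hy ha
  obtain ⟨h₁, h₂, h₃, h₄⟩ := (isDistinguished_iff Q).1 hQ
  let F := GSch.forget G
  have noeth (X : GSch G) : IsNoetherian (F.obj X) := by
    have := LocallyOfFiniteType.isLocallyNoetherian X.toBase
    exact {}
  have hF : IsPullback (F.map Q.f₁₂) (F.map Q.f₁₃) (F.map Q.f₂₄) (F.map Q.f₃₄) := h₁.map F
  have hk : IsOpenImmersion (F.map Q.f₁₂) := MorphismProperty.of_isPullback hF.flip h₂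
  obtain ⟨_, hb⟩ := hb
  obtain ⟨_, hy⟩ := hy
  obtain ⟨_, ha⟩ := ha
  -- the closed subsets to be removed
  let CA := closure (F.map Q.f₃₄ '' (Set.range (F.map a))ᶜ)
  let CB := closure (F.map Q.f₁₂ '' (Set.range (F.map b))ᶜ)
  let CY := (Set.range (F.map y))ᶜ
  -- The last two pieces are the images of the points of `Y ∖ B` that `Y'` omits; removing them
  -- keeps `Y' ⟶ X'` an isomorphism outside `A'`. Restricting to `Y ∖ B` makes these images closed.
  let W := CA ∪ F.map Q.f₂₄ '' (CY \ Set.range (F.map Q.f₁₂)) ∪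
    F.map Q.f₂₄ '' (CB \ Set.range (F.map Q.f₁₂))
  have closed_compl {U X : GSch G} (f : U ⟶ X) [IsOpenImmersion (F.map f)] :
      IsClosed (Set.range (F.map f))ᶜ :=
    (F.map f).isOpenEmbedding.isOpen_range.isClosed_compl
  have hW : IsClosed W := (isClosed_closure.union (hQ.isClosed_image (closed_compl y))).union
    (hQ.isClosed_image isClosed_closure)
  have hCB : Q.X₂.IsInvariant CB := ((GSch.IsInvariant.range b).compl.image _).closure
  have hW' : Q.X₄.IsInvariant W := by
    refine (GSch.IsInvariant.union ?_ ?_).union ?_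
    · exact ((GSch.IsInvariant.range a).compl.image _).closure
    · exact ((GSch.IsInvariant.range y).compl.inter (GSch.IsInvariant.range _).compl).image _
    · exact (hCB.inter (GSch.IsInvariant.range _).compl).image _
  have hWcodim : ∀ x ∈ W, ((i + 1 : ℕ) : ℕ∞) ≤ Order.coheight x := by
    rintro x ((hx | ⟨z, ⟨hz, -⟩, rfl⟩) | ⟨z, ⟨hz, hz'⟩, rfl⟩)
    · exact (coheight_le_of_mem_closure_image _ (closed_compl a) ha hx).1
    · exact (hy z hz).trans (coheight_le_coheight_of_etale _ z)
    · refine le_trans ?_ (coheight_le_coheight_of_etale _ z)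
      exact_mod_cast (coheight_le_of_mem_closure_image _ (closed_compl b) hb hz).2 hz'
  obtain ⟨X', iX, _, hX'⟩ := hW'.compl.exists_isOpenImmersion hW.isOpen_compl
  let VY := F.map Q.f₂₄ ⁻¹' Wᶜ ∩ (Set.range (F.map y) ∩ CBᶜ)
  have hVY : IsOpen VY := (hW.isOpen_compl.preimage (F.map Q.f₂₄).continuous).inter
    ((F.map y).isOpenEmbedding.isOpen_range.inter isClosed_closure.isOpen_compl)
  have hVY' : Q.X₂.IsInvariant VY := (hW'.compl.preimage _).inter
    ((GSch.IsInvariant.range y).inter hCB.compl)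
  obtain ⟨Y', iY, _, hY'⟩ := hVY'.exists_isOpenImmersion hVY
  obtain ⟨p', hp'⟩ := GSch.exists_lift iX (iY ≫ Q.f₂₄) (by
    rw [hX', Functor.map_comp]
    rintro _ ⟨z, rfl⟩
    rw [Scheme.Hom.comp_apply]
    exact (hY'.le (Set.mem_range_self z)).1)
  have hpF : F.map p' ≫ F.map iX = F.map iY ≫ F.map Q.f₂₄ := by
    rw [← F.map_comp, hp', F.map_comp]
  have hA := (IsPullback.of_hasPullback Q.f₃₄ iX).map F
  have hj' : IsOpenImmersion (F.map (pullback.snd Q.f₃₄ iX)) := MorphismProperty.of_isPullback hA h₂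
  let Q' : Square (GSch G) :=
    { f₁₂ := pullback.fst p' (pullback.snd Q.f₃₄ iX)
      f₁₃ := pullback.snd p' (pullback.snd Q.f₃₄ iX)
      f₂₄ := p'
      f₃₄ := pullback.snd Q.f₃₄ iX
      fac := pullback.condition }
  have hl : (pullback.fst p' (pullback.snd Q.f₃₄ iX) ≫ iY) ≫ Q.f₂₄ =
      (pullback.snd p' (pullback.snd Q.f₃₄ iX) ≫ pullback.fst Q.f₃₄ iX) ≫ Q.f₃₄ := by
    rw [Category.assoc, Category.assoc, pullback.condition, ← hp', pullback.condition_assoc]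
  have hQ₁ : IsPullback Q.f₁₂ Q.f₁₃ Q.f₂₄ Q.f₃₄ := h₁
  let φ : Q' ⟶ Q :=
    { τ₁ := hQ₁.lift _ _ hl
      τ₂ := iY
      τ₃ := pullback.fst Q.f₃₄ iX
      τ₄ := iX
      comm₁₂ := (hQ₁.lift_fst _ _ hl).symm
      comm₁₃ := (hQ₁.lift_snd _ _ hl).symm
      comm₂₄ := hp'
      comm₃₄ := pullback.condition.symm }
  have hQ' : IsDistinguished G Q' := by
    have : Etale (F.map p' ≫ F.map iX) := by rw [hpF]; infer_instance
    have : Etale (F.map p') := .of_comp _ (F.map iX)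
    exact (isDistinguished_iff Q').2 ⟨IsPullback.of_hasPullback p' (pullback.snd Q.f₃₄ iX), hj',
      this, isIsoOutside_of_isOpenImmersion hpF (hA.flip.range_fst_eq) h₄ (by
        rintro z hz hzX
        rw [hY']
        rw [hX'] at hzX
        have hzB : z ∉ Set.range (F.map Q.f₁₂) := by rwa [hF.range_fst_eq]
        exact ⟨hzX, by_contra fun h ↦ hzX (.inl (.inr ⟨z, ⟨h, hzB⟩, rfl⟩)),
          fun h ↦ hzX (.inr ⟨z, ⟨h, hzB⟩, rfl⟩)⟩)⟩
  refine ⟨Q', φ, hQ', ⟨inferInstance, fun x hx ↦ hWcodim x ?_⟩, GSch.exists_lift _ _ ?_,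
    GSch.exists_lift _ _ ?_, GSch.exists_lift _ _ ?_⟩
  · by_contra hxW
    exact hx (hX'.ge hxW)
  · rintro _ ⟨z, rfl⟩
    by_contra hz
    have e : F.map Q.f₁₂ (F.map φ.τ₁ z) = F.map iY (F.map (pullback.fst _ _) z) := by
      rw [← Scheme.Hom.comp_apply, ← F.map_comp, ← φ.comm₁₂, F.map_comp, Scheme.Hom.comp_apply]
    exact (hY'.le (Set.mem_range_self (F.map (pullback.fst _ _) z))).2.2
      (e ▸ subset_closure ⟨_, hz, rfl⟩)
  · exact hY'.le.trans fun z hz ↦ hz.2.1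
  · rintro _ ⟨z, rfl⟩
    by_contra hz
    have e : F.map Q.f₃₄ (F.map φ.τ₃ z) = F.map iX (F.map (pullback.snd Q.f₃₄ iX) z) := by
      rw [← Scheme.Hom.comp_apply, ← F.map_comp, ← φ.comm₃₄, F.map_comp, Scheme.Hom.comp_apply]
    exact hX'.le (Set.mem_range_self (F.map (pullback.snd Q.f₃₄ iX) z))
      (e ▸ .inl (.inl (subset_closure ⟨_, hz, rfl⟩)))

theorem isBounded_nisnevichCD [IsNoetherian S] (hS : topologicalKrullDim S < ⊤)
    [LocallyOfFiniteType G.hom] [Flat G.hom] : (nisnevichCD G).IsBounded :=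
  ⟨codimDensity G, isLocallyFiniteDimensional_codimDensity hS, fun Q hQ ↦
    ⟨Q, 𝟙 Q, hQ, inferInstanceAs (IsIso (𝟙 _)), isReducing_codimDensity hQ⟩⟩

end EquivariantNisnevich

/-! ### Subcanonicity by fppf descent of morphisms. -/

namespace AlgebraicGeometry

theorem ofTwoArrows_mem_fppfTopology {X Y A : Scheme.{u}} (p : Y ⟶ X) (j : A ⟶ X) [Flat p]
    [LocallyOfFinitePresentation p] [Flat j] [LocallyOfFinitePresentation j]
    (h : ∀ x, x ∈ Set.range p ∨ x ∈ Set.range j) :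
    Sieve.ofTwoArrows p j ∈ Scheme.fppfTopology X := by
  refine Precoverage.generate_mem_toGrothendieck ?_
  rw [Scheme.fppfPrecoverage, Scheme.ofArrows_mem_precoverage_iff]
  refine ⟨fun x ↦ ?_, ?_⟩
  · exact (h x).elim (fun h ↦ ⟨.left, h⟩) (fun h ↦ ⟨.right, h⟩)
  · rintro (_ | _)
    · exact ⟨‹_›, ‹_›⟩
    · exact ⟨‹_›, ‹_›⟩

theorem hom_ext_of_jointlySurjective {X Y A W : Scheme.{u}} (p : Y ⟶ X) (j : A ⟶ X) [Flat p]
    [LocallyOfFinitePresentation p] [Flat j] [LocallyOfFinitePresentation j]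
    (h : ∀ x, x ∈ Set.range p ∨ x ∈ Set.range j) {f g : X ⟶ W} (hp : p ≫ f = p ≫ g)
    (hj : j ≫ f = j ≫ g) : f = g :=
  Presieve.isSeparatedFor_ofTwoArrows (F := yoneda.obj W)
    (((GrothendieckTopology.Subcanonical.isSheaf_of_isRepresentable (J := Scheme.fppfTopology)
      (yoneda.obj W)) _ (ofTwoArrows_mem_fppfTopology p j h)).isSeparatedFor) hp hj

/-- Representable presheaves are fppf sheaves, and both the pair `Y`, `A` over `X` and the pair `Y`,
`B ×_A B` over `Y ×_X Y` are fppf coverings. -/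
theorem IsIsoOutside.op_map_yoneda_isPullback {Q : Square Scheme.{u}} (hQ : Q.IsPullback)
    [Etale Q.f₂₄] [IsOpenImmersion Q.f₃₄] (h : IsIsoOutside Q.f₂₄ (Set.range Q.f₃₄))
    (W : Scheme.{u}) : (Q.op.map (yoneda.obj W)).IsPullback := by
  have sheaf := GrothendieckTopology.Subcanonical.isSheaf_of_isRepresentable
    (J := Scheme.fppfTopology) (yoneda.obj W)
  have h₁ := Square.isPullback_relativeMap hQ
  have : IsOpenImmersion Q.relativeMap := MorphismProperty.of_isPullback h₁.flip ‹_›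
  refine Square.op_map_isPullback_of_isSheafFor hQ (sheaf _ (ofTwoArrows_mem_fppfTopology _ _ ?_))
    (sheaf _ (ofTwoArrows_mem_fppfTopology _ _ ?_)).isSeparatedFor
  · intro x
    by_cases hx : x ∈ Set.range Q.f₃₄
    · exact .inr hx
    · exact .inl (h.existsUnique hx).exists
  · intro x
    by_cases hx : x ∈ Set.range Q.relativeMap
    · exact .inl hx
    · rw [h₁.range_fst_eq] at hx
      exact .inr (h.mem_range_of_section (IsPullback.of_hasPullback Q.f₂₄ Q.f₂₄)
        (pullback.diagonal_fst _) (pullback.diagonal_snd _) hx)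

end AlgebraicGeometry

namespace EquivariantNisnevich

open MonoidalCategory CartesianMonoidalCategory

variable {S : Scheme.{u}} {G : Over S} [GrpObj G]

/-- The morphisms glue as morphisms of schemes. Compatibility with `S` is checked on the cover of
`X`, and equivariance on its base change to `G ×_S X`. -/
theorem IsDistinguished.op_map_yoneda_isPullback {Q : Square (GSch G)}
    (hQ : IsDistinguished G Q) (W : GSch G) : (Q.op.map (yoneda.obj W)).IsPullback := by
  obtain ⟨h₁, h₂, h₃, h₄⟩ := (isDistinguished_iff Q).1 hQ
  let F := GSch.forget G
  have cov (x : F.obj Q.X₄) : x ∈ Set.range (F.map Q.f₂₄) ∨ x ∈ Set.range (F.map Q.f₃₄) :=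
    hQ.exists_preimage x
  have H := @IsIsoOutside.op_map_yoneda_isPullback (Q.map F)
    (CategoryTheory.IsPullback.map F h₁) h₃ h₂ h₄ (F.obj W)
  rw [Square.op_map_isPullback_iff] at H ⊢
  intro (y : Q.X₂ ⟶ W) (a : Q.X₃ ⟶ W) (hya : Q.f₁₂ ≫ y = Q.f₁₃ ≫ a)
  obtain ⟨x₀, hx₁, hx₂⟩ : ∃ x₀ : F.obj Q.X₄ ⟶ F.obj W, F.map Q.f₂₄ ≫ x₀ = F.map y ∧
      F.map Q.f₃₄ ≫ x₀ = F.map a := by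
    refine (H (F.map y) (F.map a) ?_).exists
    change F.map Q.f₁₂ ≫ F.map y = F.map Q.f₁₃ ≫ F.map a
    rw [← F.map_comp, hya, F.map_comp]
  have hom_ext {T : Scheme.{u}} {f g : F.obj Q.X₄ ⟶ T}
      (h : F.map Q.f₂₄ ≫ f = F.map Q.f₂₄ ≫ g) (h' : F.map Q.f₃₄ ≫ f = F.map Q.f₃₄ ≫ g) : f = g :=
    hom_ext_of_jointlySurjective _ _ cov h h'
  let x : Q.X₄.obj.X ⟶ W.obj.X := Over.homMk x₀ (by
    change x₀ ≫ W.toBase = Q.X₄.toBase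
    apply hom_ext
    · rw [reassoc_of% hx₁, GSch.map_toBase, GSch.map_toBase]
    · rw [reassoc_of% hx₂, GSch.map_toBase, GSch.map_toBase])
  have hx : IsModHom G x := by
    refine .of_fst_smul_snd _ ?_
    have e : fst G Q.X₄.obj.X • (snd G Q.X₄.obj.X ≫ x) =
        (G ◁ x) ≫ (fst G W.obj.X • snd G W.obj.X) := by
      rw [ModObj.comp_smul]; simp
    rw [e]
    ext1
    change Q.X₄.act ≫ x₀ = (G ◁ x).left ≫ W.act
    have hz {Z : GSch G} (f : Z ⟶ Q.X₄) (z : Z ⟶ W) (h : F.map f ≫ x₀ = F.map z) :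
        GSch.prodMap f ≫ Q.X₄.act ≫ x₀ = GSch.prodMap f ≫ (G ◁ x).left ≫ W.act := by
      have h' : GSch.prodMap f ≫ (G ◁ x).left = GSch.prodMap z := by
        refine congr_arg CommaMorphism.left (?_ : G ◁ GSch.over f ≫ G ◁ x = G ◁ GSch.over z)
        rw [← MonoidalCategory.whiskerLeft_comp]
        congr 1
        ext1
        exact h
      rw [reassoc_of% h', GSch.prodMap_act z, ← h, ← Category.assoc, GSch.prodMap_act f,
        Category.assoc]
    have p₂ := GSch.isPullback_prodMap Q.f₂₄
    have p₃ := GSch.isPullback_prodMap Q.f₃₄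
    have e₂ : Etale (GSch.prodMap Q.f₂₄) := MorphismProperty.of_isPullback p₂.flip h₃
    have e₃ : IsOpenImmersion (GSch.prodMap Q.f₃₄) := MorphismProperty.of_isPullback p₃.flip h₂
    refine hom_ext_of_jointlySurjective _ _ (fun g ↦ ?_) (hz _ _ hx₁) (hz _ _ hx₂)
    rw [p₂.range_fst_eq, p₃.range_fst_eq]
    exact cov _
  have key (z : Q.X₄ ⟶ W) (h : Q.f₂₄ ≫ z = y) (h' : Q.f₃₄ ≫ z = a) : F.map z = x₀ := by
    apply hom_ext
    · rw [← F.map_comp, h, hx₁]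
    · rw [← F.map_comp, h', hx₂]
  refine ⟨GSch.homMk x, ⟨GSch.hom_ext ?_, GSch.hom_ext ?_⟩, fun z ⟨hz, hz'⟩ ↦ GSch.hom_ext ?_⟩
  · exact (F.map_comp _ _).trans hx₁
  · exact (F.map_comp _ _).trans hx₂
  · exact key z hz hz'

theorem subcanonical_nisnevichTopology : (nisnevichTopology G).Subcanonical := by
  refine .of_isSheaf_yoneda_obj _ fun W ↦ (isSheaf_nisnevichTopology_iff _).2 ⟨⟨?_⟩, ?_⟩
  · exact ⟨⟨(GSch.emptyIsInitial G).to W⟩, fun _ ↦ (GSch.emptyIsInitial G).hom_ext _ _⟩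
  · exact fun Q hQ ↦ hQ.op_map_yoneda_isPullback W

end EquivariantNisnevich

/-! ### Cohomology as `Ext` from free abelian sheaves, and its local vanishing. -/

namespace CategoryTheory.Sheaf



variable {C : Type u} [Category.{v} C] {J : GrothendieckTopology C}

theorem subsingleton_obj_of_bot_mem {X : C} (hX : (⊥ : Sieve X) ∈ J X)
    (F : Sheaf J AddCommGrpCat.{v}) : Subsingleton (F.obj.obj (op X)) := by
  have h := (isSheaf_iff_isSheaf_of_type _ _).1
    ((sheafCompose J (forget AddCommGrpCat.{v})).obj F).property _ hX
  exact ⟨fun a b ↦ h.isSeparatedFor.ext (fun _ _ hf ↦ hf.elim)⟩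

section Free

variable [HasSheafify J AddCommGrpCat.{v}]

variable (J) in
/-- The functor sending an object to the free abelian sheaf it generates. -/
noncomputable abbrev freeAbelian : C ⥤ Sheaf J AddCommGrpCat.{v} :=
  yoneda ⋙ (Functor.whiskeringRight _ _ _).obj AddCommGrpCat.free ⋙ presheafToSheaf J _

/-- Morphisms from the free abelian sheaf generated by `X` to `F` are sections of `F` over `X`. -/
noncomputable def freeAbelianEquiv {X : C} {F : Sheaf J AddCommGrpCat.{v}} :
    ((freeAbelian J).obj X ⟶ F) ≃ F.obj.obj (op X) :=
  (((sheafificationAdjunction J AddCommGrpCat.{v}).homEquiv _ _).trans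
    ((AddCommGrpCat.adj.whiskerRight Cᵒᵖ).homEquiv _ _)).trans yonedaEquiv

theorem freeAbelianEquiv_map {X Y : C} (f : Y ⟶ X) {F : Sheaf J AddCommGrpCat.{v}}
    (φ : (freeAbelian J).obj X ⟶ F) :
    freeAbelianEquiv ((freeAbelian J).map f ≫ φ) = F.obj.map f.op (freeAbelianEquiv φ) := by
  dsimp only [freeAbelianEquiv, Equiv.trans_apply]
  refine Eq.trans ?_ (yonedaEquiv_naturality (F := F.obj ⋙ forget AddCommGrpCat.{v}) _ f).symm
  congr 1
  rw [← Adjunction.homEquiv_naturality_left]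
  congr 1
  exact Adjunction.homEquiv_naturality_left _ _ _

theorem freeAbelianEquiv_comp {X : C} {F F' : Sheaf J AddCommGrpCat.{v}}
    (φ : (freeAbelian J).obj X ⟶ F) (π : F ⟶ F') :
    freeAbelianEquiv (φ ≫ π) = π.hom.app (op X) (freeAbelianEquiv φ) := by
  dsimp only [freeAbelianEquiv, Equiv.trans_apply]
  rw [Adjunction.homEquiv_naturality_right, Adjunction.homEquiv_naturality_right]
  rfl

theorem lift_comp_desc_freeAbelian (Q : Square C) :
    biprod.lift ((freeAbelian J).map Q.f₁₃) (-(freeAbelian J).map Q.f₁₂) ≫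
      biprod.desc ((freeAbelian J).map Q.f₃₄) ((freeAbelian J).map Q.f₂₄) = 0 := by
  rw [biprod.lift_desc, Preadditive.neg_comp, ← Functor.map_comp, ← Functor.map_comp, Q.fac,
    add_neg_cancel]

theorem isZero_freeAbelian_of_bot_mem {X : C} (hX : (⊥ : Sieve X) ∈ J X) :
    IsZero ((freeAbelian J).obj X) := by
  rw [IsZero.iff_id_eq_zero]
  apply freeAbelianEquiv.injective
  have := subsingleton_obj_of_bot_mem hX ((freeAbelian J).obj X)
  exact Subsingleton.elim _ _

theorem exists_lift_of_epi [J.WEqualsLocallyBijective AddCommGrpCat.{v}]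
    {F F' : Sheaf J AddCommGrpCat.{v}} (π : F ⟶ F') [Epi π]
    {X : C} (φ : (freeAbelian J).obj X ⟶ F') : ∃ R ∈ J X, ∀ ⦃Y : C⦄ (f : Y ⟶ X), R f →
      ∃ ψ : (freeAbelian J).obj Y ⟶ F, ψ ≫ π = (freeAbelian J).map f ≫ φ := by
  have h : Sheaf.IsLocallySurjective π :=
    (Sheaf.isLocallySurjective_iff_epi' AddCommGrpCat.{v} π).2 inferInstance
  refine ⟨_, h.imageSieve_mem (freeAbelianEquiv φ), ?_⟩
  rintro Y f ⟨t, ht⟩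
  refine ⟨freeAbelianEquiv.symm t, freeAbelianEquiv.injective ?_⟩
  rw [freeAbelianEquiv_comp, Equiv.apply_symm_apply, freeAbelianEquiv_map]
  exact ht

end Free

variable [HasSheafify J AddCommGrpCat.{v}] [HasExt.{w} (Sheaf J AddCommGrpCat.{v})]

/-- The restriction of cohomology classes along a morphism. -/
noncomputable abbrev restrict {X Y : C} (f : Y ⟶ X) {F : Sheaf J AddCommGrpCat.{v}} {n : ℕ}
    (a : Abelian.Ext ((freeAbelian J).obj X) F n) : Abelian.Ext ((freeAbelian J).obj Y) F n :=
  (Abelian.Ext.mk₀ ((freeAbelian J).map f)).comp a (zero_add n)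

theorem restrict_comp {X Y Z : C} (g : Z ⟶ Y) (f : Y ⟶ X) {F : Sheaf J AddCommGrpCat.{v}}
    {n : ℕ} (a : Abelian.Ext ((freeAbelian J).obj X) F n) :
    restrict (g ≫ f) a = restrict g (restrict f a) := by
  rw [restrict, restrict, restrict, Abelian.Ext.mk₀_comp_mk₀_assoc, Functor.map_comp]

theorem restrict_comp_eq_zero {X Y Z : C} (g : Z ⟶ Y) (f : Y ⟶ X)
    {F : Sheaf J AddCommGrpCat.{v}} {n : ℕ} {a : Abelian.Ext ((freeAbelian J).obj X) F n}
    (h : restrict f a = 0) : restrict (g ≫ f) a = 0 := by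
  rw [restrict_comp, h, restrict, Abelian.Ext.comp_zero]

theorem restrict_id {X : C} {F : Sheaf J AddCommGrpCat.{v}} {n : ℕ}
    (a : Abelian.Ext ((freeAbelian J).obj X) F n) : restrict (𝟙 X) a = a := by
  rw [restrict, CategoryTheory.Functor.map_id, Abelian.Ext.mk₀_id_comp]

theorem eq_zero_of_restrict_of_isIso {X Y : C} (f : Y ⟶ X) [IsIso f]
    {F : Sheaf J AddCommGrpCat.{v}} {n : ℕ} {a : Abelian.Ext ((freeAbelian J).obj X) F n}
    (h : restrict f a = 0) : a = 0 := by
  rw [← restrict_id a, ← IsIso.inv_hom_id f]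
  exact restrict_comp_eq_zero _ _ h

theorem ext_eq_zero_of_bot_mem {X : C} (hX : (⊥ : Sieve X) ∈ J X)
    {F : Sheaf J AddCommGrpCat.{v}} {n : ℕ} (a : Abelian.Ext ((freeAbelian J).obj X) F n) : a = 0 := by
  rw [← Abelian.Ext.mk₀_id_comp a, (isZero_freeAbelian_of_bot_mem hX).eq_of_src (𝟙 _) 0, Abelian.Ext.mk₀_zero,
    Abelian.Ext.zero_comp]

/-- Cohomology classes of positive degree vanish locally. -/
theorem exists_cover_restrict_eq_zero [J.WEqualsLocallyBijective AddCommGrpCat.{v}]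
    [EnoughInjectives (Sheaf J AddCommGrpCat.{v})] (n : ℕ) :
    ∀ (F : Sheaf J AddCommGrpCat.{v}) {X : C} (a : Abelian.Ext ((freeAbelian J).obj X) F (n + 1)),
      ∃ R ∈ J X, ∀ ⦃Y : C⦄ (f : Y ⟶ X), R f → restrict f a = 0 := by
  induction n with
  | zero =>
    intro F X a
    let T : ShortComplex (Sheaf J AddCommGrpCat.{v}) :=
      ShortComplex.mk (Injective.ι F) (cokernel.π (Injective.ι F)) (cokernel.condition _)
    have hT : T.ShortExact :=
      { exact := ShortComplex.exact_of_g_is_cokernel _ (cokernelIsCokernel _) }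
    have : Injective T.X₂ := inferInstanceAs (Injective (Injective.under F))
    -- The class is the boundary of a section of the quotient of an injective sheaf by `F`, and this
    -- section lifts locally.
    obtain ⟨c, rfl⟩ := Abelian.Ext.covariant_sequence_exact₁ _ hT a (Abelian.Ext.eq_zero_of_injective _) rfl
    obtain ⟨φ, rfl⟩ := (Abelian.Ext.mk₀_bijective _ _).2 c
    have : Epi T.g := hT.epi_g
    obtain ⟨R, hR, H⟩ := exists_lift_of_epi T.g φ
    refine ⟨R, hR, fun Y f hf ↦ ?_⟩
    obtain ⟨ψ, hψ⟩ := H f hf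
    rw [restrict, Abelian.Ext.mk₀_comp_mk₀_assoc, ← hψ, ← Abelian.Ext.mk₀_comp_mk₀_assoc, hT.comp_extClass,
      Abelian.Ext.comp_zero]
  | succ n ih =>
    intro F X a
    let T : ShortComplex (Sheaf J AddCommGrpCat.{v}) :=
      ShortComplex.mk (Injective.ι F) (cokernel.π (Injective.ι F)) (cokernel.condition _)
    have hT : T.ShortExact :=
      { exact := ShortComplex.exact_of_g_is_cokernel _ (cokernelIsCokernel _) }
    have : Injective T.X₂ := inferInstanceAs (Injective (Injective.under F))
    -- Dimension shift: `c` has degree one less and values in the quotient sheaf.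
    obtain ⟨c, rfl⟩ := Abelian.Ext.covariant_sequence_exact₁ _ hT a (Abelian.Ext.eq_zero_of_injective _) rfl
    obtain ⟨R, hR, H⟩ := ih _ c
    refine ⟨R, hR, fun Y f hf ↦ ?_⟩
    rw [restrict, ← Abelian.Ext.comp_assoc _ _ _ (zero_add _) (by omega) (by omega)]
    have := H f hf
    rw [restrict] at this
    rw [this, Abelian.Ext.zero_comp]

end CategoryTheory.Sheaf

/-! ### The Mayer–Vietoris boundary and its naturality. -/

namespace CategoryTheory.Abelian.Ext

variable {A : Type u} [Category.{v} A] [Abelian A] [HasExt.{w} A] {Z₁ Z₂ Z₃ Z₄ : A}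
  {f₁₂ : Z₁ ⟶ Z₂} {f₁₃ : Z₁ ⟶ Z₃} {f₂₄ : Z₂ ⟶ Z₄} {f₃₄ : Z₃ ⟶ Z₄}
  {h : biprod.lift f₁₂ (-f₁₃) ≫ biprod.desc f₂₄ f₃₄ = 0} {F : A} {n : ℕ}

theorem exists_extClass_comp_eq
    (hT : (ShortComplex.mk (biprod.lift f₁₂ (-f₁₃)) (biprod.desc f₂₄ f₃₄) h).ShortExact)
    (a : Ext Z₄ F (n + 1)) (h₂ : (mk₀ f₂₄).comp a (zero_add _) = 0)
    (h₃ : (mk₀ f₃₄).comp a (zero_add _) = 0) :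
    ∃ b : Ext Z₁ F n, hT.extClass.comp b (add_comm 1 n) = a := by
  refine contravariant_sequence_exact₃ hT F a ?_ (add_comm 1 n)
  apply biprod_ext
  · rw [comp_zero, mk₀_comp_mk₀_assoc, biprod.inl_desc, h₂]
  · rw [comp_zero, mk₀_comp_mk₀_assoc, biprod.inr_desc, h₃]

variable {Z₁' Z₂' Z₃' Z₄' : A}
  {f₁₂' : Z₁' ⟶ Z₂'} {f₁₃' : Z₁' ⟶ Z₃'} {f₂₄' : Z₂' ⟶ Z₄'} {f₃₄' : Z₃' ⟶ Z₄'}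
  {h' : biprod.lift f₁₂' (-f₁₃') ≫ biprod.desc f₂₄' f₃₄' = 0}

/-- By naturality of the extension class, restricting the boundary of `b` along `t₄` gives the
boundary of the restriction of `b` along `t₁`. -/
theorem mk₀_comp_extClass_comp_eq_zero
    (hT : (ShortComplex.mk (biprod.lift f₁₂ (-f₁₃)) (biprod.desc f₂₄ f₃₄) h).ShortExact)
    (hT' : (ShortComplex.mk (biprod.lift f₁₂' (-f₁₃')) (biprod.desc f₂₄' f₃₄') h').ShortExact)
    (t₁ : Z₁' ⟶ Z₁) (t₂ : Z₂' ⟶ Z₂) (t₃ : Z₃' ⟶ Z₃) (t₄ : Z₄' ⟶ Z₄)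
    (c₁₂ : f₁₂' ≫ t₂ = t₁ ≫ f₁₂) (c₁₃ : f₁₃' ≫ t₃ = t₁ ≫ f₁₃)
    (c₂₄ : f₂₄' ≫ t₄ = t₂ ≫ f₂₄) (c₃₄ : f₃₄' ≫ t₄ = t₃ ≫ f₃₄) {b : Ext Z₁ F n}
    (hb : (mk₀ t₁).comp b (zero_add n) = 0) :
    (mk₀ t₄).comp (hT.extClass.comp b (add_comm 1 n)) (zero_add _) = 0 := by
  have := ShortComplex.ShortExact.extClass_naturality hT' hT
    { τ₁ := t₁
      τ₂ := biprod.map t₂ t₃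
      τ₃ := t₄
      comm₁₂ := by
        apply biprod.hom_ext
        · simp [c₁₂]
        · simp [c₁₃]
      comm₂₃ := by
        apply biprod.hom_ext'
        · simp [c₂₄]
        · simp [c₃₄] }
  rw [← comp_assoc _ _ _ (zero_add 1) (by omega) (by omega), ← this,
    comp_assoc_of_second_deg_zero, hb, comp_zero]

end CategoryTheory.Abelian.Ext

/-! ### Vanishing of cohomology for complete cd-structures with reducing squares. -/

namespace EquivariantNisnevich

open Sheaf

namespace CDStructure

variable {C : Type u} [Category.{v} C] [HasInitial C] {P : CDStructure C}
  [HasSheafify P.topology (Type v)] [HasSheafify P.topology AddCommGrpCat.{v}]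
  (hM : ∀ Q : Square C, P.Distinguished Q → Q.IsPullback ∧ Mono Q.f₃₄)
  (hS : ∀ (F : Sheaf P.topology (Type v)) (Q : Square C), P.Distinguished Q →
    (Q.op.map F.obj).IsPullback)

include hM hS in
-- The Mayer–Vietoris sequence of the square, which is flipped so that `B ⟶ Y`, a monomorphism as a
-- base change of `A ⟶ X`, stands in the required position.
theorem shortExact_of_distinguished {Q : Square C} (hQ : P.Distinguished Q)
    (h : biprod.lift ((freeAbelian P.topology).map Q.f₁₃) (-(freeAbelian P.topology).map Q.f₁₂) ≫
      biprod.desc ((freeAbelian P.topology).map Q.f₃₄) ((freeAbelian P.topology).map Q.f₂₄) = 0) :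
    (ShortComplex.mk _ _ h).ShortExact :=
  have : Mono Q.flip.f₁₃ := by
    have : Mono Q.f₃₄ := (hM Q hQ).2
    exact (hM Q hQ).1.mono_f₁₂
  let M : P.topology.MayerVietorisSquare := .mk' Q.flip fun F ↦ (hS F Q hQ).flip
  M.shortComplex_shortExact

variable [HasExt.{w} (Sheaf P.topology AddCommGrpCat.{v})]
  {D : DensityStructure C} {F : Sheaf P.topology AddCommGrpCat.{v}}

include hM hS in
-- Induction on the covering, using reducing squares twice. First the square is shrunk to one where
-- `a` dies on `Y` and `A`, so that `a` is the boundary of a class `b` of degree `i` on the corner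
-- `B`. Then `b` dies on an element of `D_i`, and shrinking again to that element kills `a`.
theorem exists_restrict_eq_zero_of_simpleCovering
    (hD : ∀ Q : Square C, P.Distinguished Q → D.IsReducing P Q) {i : ℕ}
    (ih : ∀ (X : C) (a : Abelian.Ext ((freeAbelian P.topology).obj X) F i),
      ∃ (X' : C) (f : X' ⟶ X), D.D i f ∧ restrict f a = 0)
    {X : C} {T : Presieve X} (hT : P.SimpleCovering X T)
    (a : Abelian.Ext ((freeAbelian P.topology).obj X) F (i + 1))
    (ha : ∀ ⦃Y : C⦄ (g : Y ⟶ X), T g → restrict g a = 0) :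
    ∃ (X' : C) (f : X' ⟶ X), D.D (i + 1) f ∧ restrict f a = 0 := by
  induction hT with
  | of_isIso f hf => exact ⟨_, f, D.of_isIso _ _ hf, ha f ⟨⟩⟩
  | of_square Q hQ R T _ _ ihR ihT =>
    obtain ⟨Y₀, y, hy, hya⟩ := ihR (restrict Q.f₂₄ a) fun Y g hg ↦ by
      rw [← restrict_comp]; exact ha _ (.inl ⟨g, hg, rfl⟩)
    obtain ⟨A₀, z, hz, hza⟩ := ihT (restrict Q.f₃₄ a) fun Y g hg ↦ by
      rw [← restrict_comp]; exact ha _ (.inr ⟨g, hg, rfl⟩)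
    obtain ⟨Q', φ, hQ', hφ, -, ⟨t₂, ht₂⟩, ⟨t₃, ht₃⟩⟩ :=
      -- No condition is imposed at `B` yet: the class to be killed there exists only after this
      -- shrinking.
      hD Q hQ i (𝟙 _) y z (D.of_isIso _ _ inferInstance) hy hz
    have h₂ : restrict Q'.f₂₄ (restrict φ.τ₄ a) = 0 := by
      rw [← restrict_comp, φ.comm₂₄, ← ht₂, Category.assoc]
      exact restrict_comp_eq_zero _ _ (by rw [restrict_comp, hya])
    have h₃ : restrict Q'.f₃₄ (restrict φ.τ₄ a) = 0 := by
      rw [← restrict_comp, φ.comm₃₄, ← ht₃, Category.assoc]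
      exact restrict_comp_eq_zero _ _ (by rw [restrict_comp, hza])
    have hT' := shortExact_of_distinguished hM hS hQ' (lift_comp_desc_freeAbelian Q')
    obtain ⟨b, hb⟩ := Abelian.Ext.exists_extClass_comp_eq hT' _ h₃ h₂
    obtain ⟨B₀, g, hg, hgb⟩ := ih Q'.X₁ b
    obtain ⟨Q'', ψ, hQ'', hψ, ⟨t₁, ht₁⟩, -, -⟩ :=
      hD Q' hQ' i g (𝟙 _) (𝟙 _) hg (D.of_isIso _ _ inferInstance) (D.of_isIso _ _ inferInstance)
    refine ⟨_, ψ.τ₄ ≫ φ.τ₄, D.comp _ _ _ hψ hφ, ?_⟩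
    have hψb : restrict ψ.τ₁ b = 0 := by
      rw [← ht₁]
      exact restrict_comp_eq_zero _ _ hgb
    rw [restrict_comp, ← hb]
    exact Abelian.Ext.mk₀_comp_extClass_comp_eq_zero hT'
      (shortExact_of_distinguished hM hS hQ'' (lift_comp_desc_freeAbelian Q''))
      ((freeAbelian P.topology).map ψ.τ₁) ((freeAbelian P.topology).map ψ.τ₃)
      ((freeAbelian P.topology).map ψ.τ₂) ((freeAbelian P.topology).map ψ.τ₄)
      (by rw [← Functor.map_comp, ← Functor.map_comp, ψ.comm₁₃])
      (by rw [← Functor.map_comp, ← Functor.map_comp, ψ.comm₁₂])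
      (by rw [← Functor.map_comp, ← Functor.map_comp, ψ.comm₃₄])
      (by rw [← Functor.map_comp, ← Functor.map_comp, ψ.comm₂₄]) hψb

include hM hS in
/-- Classes of degree `i` vanish on an element of `D_i(X)`. -/
theorem exists_restrict_eq_zero [P.topology.WEqualsLocallyBijective AddCommGrpCat.{v}]
    [EnoughInjectives (Sheaf P.topology AddCommGrpCat.{v})] (hP : P.IsComplete)
    (hD : ∀ Q : Square C, P.Distinguished Q → D.IsReducing P Q) (i : ℕ) :
    ∀ (X : C) (a : Abelian.Ext ((freeAbelian P.topology).obj X) F i),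
      ∃ (X' : C) (f : X' ⟶ X), D.D i f ∧ restrict f a = 0 := by
  induction i with
  | zero =>
    -- The initial object belongs to `D_0`, and all classes on it vanish.
    exact fun X a ↦ ⟨_, initial.to X, D.initial_mem X, ext_eq_zero_of_bot_mem P.bot_mem_topology _⟩
  | succ i ih =>
    intro X a
    obtain h | ⟨⟨e⟩⟩ := isEmpty_or_nonempty (X ≅ ⊥_ C)
    · obtain ⟨R, hR, H⟩ := exists_cover_restrict_eq_zero i F a
      obtain ⟨T, hT, hTR⟩ := hP X h R hR
      exact exists_restrict_eq_zero_of_simpleCovering hM hS hD ih hT a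
        fun Y g hg ↦ H g (hTR _ (Sieve.le_generate _ _ _ hg))
    · exact ⟨_, e.inv, D.of_isIso _ _ inferInstance,
        ext_eq_zero_of_bot_mem P.bot_mem_topology _⟩

end CDStructure

theorem subsingleton_H'_of_topologicalKrullDim_lt {S : Scheme.{u}} [IsNoetherian S]
    [S.IsSeparated] {G : Over S} [GrpObj G] [LocallyOfFiniteType G.hom] [Flat G.hom]
    (F : Sheaf (nisnevichTopology G) AddCommGrpCat.{u}) (X : GSch G) (i : ℕ)
    (hi : topologicalKrullDim ((GSch.forget G).obj X) < i) : Subsingleton (Sheaf.H' F i X) := by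
  refine subsingleton_of_forall_eq 0 fun a ↦ ?_
  have : HasSheafify (nisnevichCD G).topology AddCommGrpCat.{u} := hasSheafify_ab G _
  have : (nisnevichCD G).topology.WEqualsLocallyBijective AddCommGrpCat.{u} :=
    GrothendieckTopology.WEqualsLocallyBijective.ofEssentiallySmall.{u} _
  have : EnoughInjectives (Sheaf (nisnevichCD G).topology AddCommGrpCat.{u}) :=
    IsGrothendieckAbelian.enoughInjectives.{u}
  obtain ⟨X', f, hf, hfa⟩ := CDStructure.exists_restrict_eq_zero (P := nisnevichCD G)
    (fun Q hQ ↦ ⟨hQ.isPullback, hQ.mono⟩)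
    (fun F Q hQ ↦ ((isSheaf_nisnevichTopology_iff F.obj).1
      ((isSheaf_iff_isSheaf_of_type _ _).1 F.property)).2 Q hQ)
    isComplete_nisnevichCD (fun Q hQ ↦ isReducing_codimDensity hQ) i X a
  -- No point of `X` has codimension `i > dim X`, so the element of `D_i(X)` on which `a` dies is
  -- all of `X`.
  have : IsIso f := isIso_of_codimDensity hf fun x ↦ by
    rw [← krullDim_eq_topologicalKrullDim] at hi
    exact WithBot.coe_lt_coe.1 ((Order.coheight_le_krullDim x).trans_lt hi)
  exact eq_zero_of_restrict_of_isIso f hfa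

end EquivariantNisnevich

theorem mainTheorem7 (S : Scheme.{u}) [IsNoetherian S] [S.IsSeparated]
    (hS : topologicalKrullDim S < ⊤)
    (G : Over S) [GrpObj G] [IsSeparated G.hom] [LocallyOfFiniteType G.hom]
    [QuasiCompact G.hom] [Flat G.hom] :
    (nisnevichCD G).IsComplete ∧ (nisnevichCD G).IsRegular ∧ (nisnevichCD G).IsBounded ∧
    (∀ F : (GSch G)ᵒᵖ ⥤ Type w, Presieve.IsSheaf (nisnevichTopology G) F ↔
      Nonempty (Unique (F.obj (op (GSch.empty G)))) ∧
        ∀ Q : Square (GSch G), IsDistinguished G Q → (Q.op.map F).IsPullback) ∧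
    (nisnevichTopology G).Subcanonical ∧
    (∀ (F : Sheaf (nisnevichTopology G) AddCommGrpCat.{u}) (X : GSch G) (i : ℕ),
      topologicalKrullDim ((GSch.forget G).obj X) < i → Subsingleton (Sheaf.H' F i X)) := by
  refine ⟨isComplete_nisnevichCD, isRegular_nisnevichCD, isBounded_nisnevichCD hS,
    isSheaf_nisnevichTopology_iff, subcanonical_nisnevichTopology,
    subsingleton_H'_of_topologicalKrullDim_lt⟩
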